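/- Let $u_0\in L^\infty(\mathbb R)$ with $0\le u_0\le 1$ a.e. and $\mathrm{TotVar}\,u_0<+\infty$; let $V:\mathbb R\to\mathbb R$ be Lipschitz continuous on $\mathbb R$ and non-increasing on $[0,1]$; let $\eta\in L^1(\mathbb R)\cap L^\infty(\mathbb R)$ satisfy $\eta\ge 0$, $\mathrm{supp}\,\eta\subseteq\,]-\infty,0]$, $\int_{-\infty}^0\eta(x)\,dx=1$, and let $\eta$ be non-decreasing and convex on $]-\infty,0[$. For $\varepsilon>0$ set $\eta_\varepsilon(x)=\frac1\varepsilon\,\eta\left(\frac x\varepsilon\right)$, and let $u_\varepsilon\in L^\infty([0,+\infty[\times\mathbb R)$ be the distributional solution of the Cauchy problem $$\partial_t u_\varepsilon+\partial_x\big[V(u_\varepsilon*\eta_\varepsilon)\,u_\varepsilon\big]=0,\qquad u_\varepsilon(0,\cdot)=u_0,$$ where $*$ is the convolution in the $x$ variable only; that is, for every $\varphi\in C^\infty_c(\mathbb R^2)$, $$\int_0^{+\infty}\!\!\int_{\mathbb R}u_\varepsilon\big[\partial_t\varphi+V(u_\varepsilon*\eta_\varepsilon)\,\partial_x\varphi\big]\,dx\,dt+\int_{\mathbb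 R}u_0(x)\,\varphi(0,x)\,dx=0.$$ Set $w_\varepsilon(t,\cdot)=u_\varepsilon(t,\cdot)*\eta_\varepsilon$ for $t>0$ and $w_\varepsilon(0,\cdot)=u_0*\eta_\varepsilon$. Then, for every $\varepsilon>0$ and a.e. $t>0$, $$\mathrm{TotVar}\,w_\varepsilon(t,\cdot)\le\mathrm{TotVar}\,w_\varepsilon(0,\cdot)\le\mathrm{TotVar}\,u_0 .$$ Here $\mathrm{TotVar}\,v\in[0,+\infty]$ is the (essential) total variation of $v$ on $\mathbb R$: the infimum, over all functions equal to $v$ almost everywhere, of their pointwise variation. -/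

import Mathlib

open MeasureTheory Set
open scoped ContDiff

/-- Anisotropic convolution kernels: `η ∈ L¹ ∩ L^∞`, `supp η ⊆ ]-∞, 0]`, `η ≥ 0`, `η` is
non-decreasing on the negative half-line and has unit mass there. The value at the single
point `0`, which is irrelevant for an element of `L¹`, is left free. -/
structure IsAnisotropicKernel (η : ℝ → ℝ) : Prop where
  integrable : Integrable η volume
  bounded : MemLp η ⊤ volume
  support_subset : Function.support η ⊆ Iic 0
  nonneg : ∀ x, 0 ≤ η x
  monotone : MonotoneOn η (Iio 0)
  mass_one : ∫ x in Iic (0 : ℝ), η x = 1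

/-- The rescaled kernel `η_ε(x) = ε⁻¹ η(x / ε)`. -/
noncomputable def rescaledKernel (η : ℝ → ℝ) (ε : ℝ) (x : ℝ) : ℝ :=
  (1 / ε) * η (x / ε)

/-- The convolution `(v ∗ η_ε)(x) = ∫ η_ε(x - y) v(y) dy` in the space variable. -/
noncomputable def nonlocalTerm (η : ℝ → ℝ) (ε : ℝ) (v : ℝ → ℝ) (x : ℝ) : ℝ :=
  ∫ y, rescaledKernel η ε (x - y) * v y

/-- The closed half-plane `[0, ∞[ × ℝ` of points `(t, x)`. -/
def halfPlane : Set (ℝ × ℝ) := Ici 0 ×ˢ univ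

/-- `u = u(t, x)` is a distributional solution in `L^∞([0, ∞[ × ℝ)` of the Cauchy problem
`∂ₜ u + ∂ₓ [V(u ∗ η_ε) u] = 0`, `u(0, ·) = u₀`. The test functions need not vanish at `t = 0`,
so that the identity contains the initial condition. -/
structure IsDistributionalSolution (V η : ℝ → ℝ) (ε : ℝ) (u₀ : ℝ → ℝ) (u : ℝ → ℝ → ℝ) :
    Prop where
  bounded : MemLp (fun p : ℝ × ℝ => u p.1 p.2) ⊤ (volume.restrict halfPlane)
  weak_form : ∀ φ : ℝ × ℝ → ℝ, ContDiff ℝ ∞ φ → HasCompactSupport φ →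
    (∫ p in halfPlane,
        u p.1 p.2 * (fderiv ℝ φ p (1, 0) + V (nonlocalTerm η ε (u p.1) p.2) * fderiv ℝ φ p (0, 1)))
      + ∫ x, u₀ x * φ (0, x) = 0

/-- The total variation on `ℝ` of (the almost-everywhere class of) `v`: the infimum of the
pointwise variations of all functions that agree with `v` almost everywhere. -/
noncomputable def totVar (v : ℝ → ℝ) : ENNReal :=
  ⨅ (g : ℝ → ℝ) (_ : g =ᵐ[volume] v), eVariationOn g univ

/-! Write `κ` for the rescaled kernel. Since `κ` is non-decreasing and convex on the negative
half-line and vanishes at `-∞`, it has a layer-cake form `κ(-z) = ∫_z^∞ k(s) ds` for `z > 0`, with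
`k ≥ 0` non-increasing on `]0, ∞[`. The conservation law provides a Lipschitz potential `U` with
`∂ₓU = u` and `∂ₜU = -V(w)u`, and Fubini turns the convolution into `w(t, x) = ∫ k(z) (U(t, x + z) -
U(t, x)) dz`. So `U` is merely transported with speed `V(w)`, and no regularity of `u` is needed.

In time `h` one has `U(t + h, x) = U(t, x - h V(w(t + h, x))) + O(h²)`. Hence `w(t + h, x)` equals
`w(t, ·)` at the foot of the characteristic, plus the defect `∫ k(y - x) [U(t, y - h V(w(y))) - U(t,
y - h V(w(x)))] dy`, plus `O(h²)`, where `w` inside the defect is taken at time `t + h`. The map `r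
↦ U(t, y - h V(r))` is non-decreasing on `[0, 1]`, because `U(t, ·)` is non-decreasing and `V` is
non-increasing there; this requires the bounds `0 ≤ w ≤ 1`, from `IsTransportedPotential.monotone`
and `IsTransportedPotential.average_le_one`.

The variation is governed by alternating sums `∑ ±w(xᵢ)` along non-increasing sequences. At a
near-maximiser of such a sum at time `t + h`, each `xᵢ` is nearly extremal among its admissible
positions, which fixes the signs in the defects. For fixed `y` the weights `k(y - xᵢ)` decrease
along those `xᵢ` lying left of `y`, so Abel summation makes the signed sum of defects at most
`O(h²)` (`sum_alternating_weighted_le`). The feet are again ordered, so the supremum grows by at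
most `O(h²)` per step (`IsTransportedPotential.alternating_sum_le`), and `forall_of_step` lets `h →
0`. Alternating sums are converted to and from variation by `two_mul_sum_alternating_le` and
`eVariationOn_le_of_sum_alternating_le`. The bound by the variation of the datum is the usual
estimate for averages. -/

open Filter Topology

/-! ### Discrete Grönwall and Abel summation for alternating sums. -/

/-- Discrete Grönwall principle for a monotone family of predicates `p t e`. -/
theorem forall_of_step {p : ℝ → ℝ → Prop} {A B h₀ : ℝ} (hA : 0 ≤ A) (hB : 0 ≤ B) (hh₀ : 0 < h₀)
    (mono : ∀ t e e', p t e → e ≤ e' → p t e') (zero : p 0 0)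
    (step : ∀ t h e, 0 ≤ t → 0 < h → h ≤ h₀ → 0 ≤ e → p t e →
      p (t + h) ((1 + A * h) * e + B * h ^ 2)) {t : ℝ} (ht : 0 ≤ t) {δ : ℝ} (hδ : 0 < δ) :
    p t δ := by
  rcases ht.eq_or_lt with rfl | ht
  · exact mono _ _ _ zero hδ.le
  -- The first bound makes `t / n` an admissible step. The second makes the accumulated error `n B
  -- (t / n)² exp(A t) = B t² exp(A t) / n` smaller than `δ`.
  obtain ⟨n, hn⟩ := exists_nat_gt (max (t / h₀) (B * t ^ 2 * Real.exp (A * t) / δ))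
  have hn1 : t / h₀ < n := (le_max_left _ _).trans_lt hn
  have hn2 : B * t ^ 2 * Real.exp (A * t) / δ < n := (le_max_right _ _).trans_lt hn
  have hn0 : (0 : ℝ) < n := lt_of_le_of_lt (by positivity) hn1
  set h := t / n with hh
  have hh0 : 0 < h := by positivity
  have hhle : h ≤ h₀ := by
    rw [hh, div_le_iff₀ hn0]; rw [div_lt_iff₀ hh₀] at hn1; nlinarith
  have key : ∀ i : ℕ, p (i * h) (i * (B * h ^ 2) * Real.exp (A * (i * h))) := by
    intro i
    induction i with
    | zero => simpa using zero
    | succ i ih =>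
      have := step (i * h) h _ (by positivity) hh0 hhle (by positivity) ih
      have e1 : ((i + 1 : ℕ) : ℝ) * h = i * h + h := by push_cast; ring
      rw [e1]
      refine mono _ _ _ this ?_
      have e2 : Real.exp (A * (i * h + h)) = Real.exp (A * (i * h)) * Real.exp (A * h) := by
        rw [← Real.exp_add]; ring_nf
      have e3 : 1 + A * h ≤ Real.exp (A * h) := by
        have := Real.add_one_le_exp (A * h); linarith
      have e4 : 1 ≤ Real.exp (A * (i * h + h)) := Real.one_le_exp (by positivity)
      have e5 : 0 ≤ i * (B * h ^ 2) * Real.exp (A * (i * h)) := by positivity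
      have e6 : 0 ≤ B * h ^ 2 := by positivity
      calc _ ≤ Real.exp (A * h) * (i * (B * h ^ 2) * Real.exp (A * (i * h)))
            + B * h ^ 2 * Real.exp (A * (i * h + h)) := by
              exact add_le_add (mul_le_mul_of_nonneg_right e3 e5) (le_mul_of_one_le_right e6 e4)
        _ = _ := by rw [e2]; push_cast; ring
  have := key n
  have e1 : n * h = t := by rw [hh]; field_simp
  rw [e1] at this
  refine mono _ _ _ this ?_
  have : n * (B * h ^ 2) * Real.exp (A * t) = B * t ^ 2 * Real.exp (A * t) / n := by
    rw [hh]; field_simp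
  rw [this, div_le_iff₀ hn0]
  rw [div_lt_iff₀ hδ] at hn2
  linarith

/-- Abel summation bound: weights `κ` decreasing, partial sums of `a` at most `D`. -/
theorem sum_antitone_mul_le {a κ : ℕ → ℝ} {D : ℝ} (n : ℕ) (hκ : ∀ i, i + 1 < n → κ (i + 1) ≤ κ i)
    (hκ0 : ∀ i < n, 0 ≤ κ i)
    (ha : ∀ m ≤ n, ∑ i ∈ Finset.range m, a i ≤ D) :
    ∑ i ∈ Finset.range n, κ i * a i ≤ κ 0 * D ∨ n = 0 := by
  rcases n with _ | n
  · exact Or.inr rfl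
  left
  have key : ∀ m ≤ n, ∑ i ∈ Finset.range (m + 1), κ i * a i
      ≤ (κ 0 - κ m) * D + κ m * ∑ i ∈ Finset.range (m + 1), a i := by
    intro m
    induction m with
    | zero => intro _; simp
    | succ m ih =>
      intro hm
      have h1 := ih (by omega)
      have h2 := ha (m + 1) (by omega)
      have h3 := hκ m (by omega)
      rw [Finset.sum_range_succ, Finset.sum_range_succ (n := m + 1) (f := a)]
      nlinarith
  have h1 := key n le_rfl
  have h2 := ha (n + 1) le_rfl
  have h3 := hκ0 n (by omega)
  nlinarith

/-- Terms are grouped in consecutive pairs from the end, each costing at most `d`; for odd `m` the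
unpaired first term is covered by `near`. -/
theorem sum_alternating_le {σ d : ℝ} {F : ℕ → ℝ} {n : ℕ} (hd : 0 ≤ d)
    (near : 0 < n → σ * F 0 ≤ d)
    (pair : ∀ i, i + 1 < n → σ * (-1) ^ (i + 1) * (F (i + 1) - F i) ≤ d) :
    ∀ m ≤ n, ∑ i ∈ Finset.range m, σ * (-1) ^ i * F i ≤ m * d
  | 0, _ => by simp
  | 1, h => by simpa using near h
  | m + 2, h => by
    have h1 := sum_alternating_le hd near pair m (by omega)
    have h2 := pair m (by omega)
    rw [Finset.sum_range_succ, Finset.sum_range_succ]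
    push_cast
    have : σ * (-1) ^ (m + 1) * (F (m + 1) - F m)
      = σ * (-1) ^ m * F m + σ * (-1) ^ (m + 1) * F (m + 1) := by ring
    linarith

/-- The pointwise inequality behind the decay of alternating sums. -/
theorem sum_alternating_weighted_le {σ d y : ℝ} {F κ x : ℕ → ℝ} {N : ℕ} (hd : 0 ≤ d)
    (hx : Antitone x)
    (hκ0 : ∀ i, 0 ≤ κ i) (hκz : ∀ i, y ≤ x i → κ i = 0)
    (hκ : ∀ i, x i < y → κ (i + 1) ≤ κ i)
    (near : ∀ j ≤ N, x j < y → (∀ i < j, y ≤ x i) → σ * (-1) ^ j * F j ≤ d)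
    (pair : ∀ i, i + 1 ≤ N → σ * (-1) ^ (i + 1) * (F (i + 1) - F i) ≤ d) :
    ∑ i ∈ Finset.range (N + 1), σ * (-1) ^ i * (κ i * F i)
      ≤ (N + 1) * d * ∑ i ∈ Finset.range (N + 1), κ i := by
  have hS : 0 ≤ ∑ i ∈ Finset.range (N + 1), κ i := Finset.sum_nonneg fun i _ => hκ0 i
  by_cases H : ∃ j, j ≤ N ∧ x j < y
  swap
  · push Not at H
    rw [Finset.sum_eq_zero]
    · positivity
    · intro i hi
      rw [hκz i (H i (by simpa [Nat.lt_succ_iff] using hi))]; ring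
  classical
  -- `j` is the first index with `x j` to the left of `y`. Earlier weights vanish, and from `j` on
  -- the weights decrease, so Abel summation applies to the tail.
  obtain ⟨j, hjN, hjy, hmin⟩ : ∃ j, j ≤ N ∧ x j < y ∧ ∀ i < j, y ≤ x i := by
    refine ⟨Nat.find H, (Nat.find_spec H).1, (Nat.find_spec H).2, fun i hi => ?_⟩
    have h1 := Nat.find_min H hi
    have h2 := (Nat.find_spec H).1
    push Not at h1
    exact h1 (by omega)
  obtain ⟨n, rfl⟩ := Nat.exists_eq_add_of_le hjN
  rw [show j + n + 1 = j + (n + 1) by ring, Finset.sum_range_add, Finset.sum_eq_zero (s := .range j)]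
  swap
  · intro i hi
    rw [hκz i (hmin i (by simpa using hi))]; ring
  rw [zero_add]
  have hxy : ∀ i, x (j + i) < y := fun i => (hx (by omega)).trans_lt hjy
  have h1 := sum_alternating_le (σ := σ * (-1) ^ j) (F := fun i => F (j + i)) (n := n + 1) hd
    (fun _ => by simpa using near j (by omega) hjy hmin)
    (fun i hi => by
      have := pair (j + i) (by omega)
      rw [pow_add, pow_add] at this
      simpa [pow_succ, mul_assoc, add_assoc] using this)
  have h2 := sum_antitone_mul_le (a := fun i => σ * (-1) ^ j * (-1) ^ i * F (j + i))
    (κ := fun i => κ (j + i)) (D := (n + 1) * d) (n + 1)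
    (fun i _ => hκ (j + i) (hxy i)) (fun i _ => hκ0 _)
    (fun m hm => (h1 m hm).trans (by
      have : (m : ℝ) ≤ n + 1 := by exact_mod_cast hm
      gcongr))
  rcases h2 with h2 | h2
  swap
  · omega
  calc _ = ∑ i ∈ Finset.range (n + 1), κ (j + i) * (σ * (-1) ^ j * (-1) ^ i * F (j + i)) := by
        refine Finset.sum_congr rfl fun i _ => ?_
        rw [pow_add]; ring
    _ ≤ κ j * ((n + 1) * d) := h2
    _ ≤ _ := by
      have h3 : κ j ≤ ∑ i ∈ Finset.range (j + (n + 1)), κ i :=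
        Finset.single_le_sum (f := κ) (fun i _ => hκ0 i) (by simp)
      push_cast
      have : (n + 1) * d ≤ (j + n + 1) * d := by
        have : (0 : ℝ) ≤ j := by positivity
        nlinarith
      calc _ ≤ κ j * ((j + n + 1) * d) := by gcongr; exact hκ0 j
        _ = (j + n + 1) * d * κ j := by ring
        _ ≤ _ := by gcongr

/-! ### Averages of increments against decreasing kernels. -/

/-- Nonnegative integrable kernels on `]0, ∞[` that are non-increasing and have unit first
moment. -/
structure IsDecreasingKernel (k : ℝ → ℝ) : Prop where
  nonneg : ∀ z, 0 ≤ k z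
  eq_zero : ∀ z ≤ 0, k z = 0
  antitoneOn : AntitoneOn k (Ioi 0)
  integrable : Integrable k
  integrable_mul : Integrable fun z => z * k z
  mass : ∫ z, z * k z = 1

/-- The nonlocal average `∫ k(z) (P(x + z) - P(x)) dz` of the derivative of `P`. -/
noncomputable def potentialAverage (k P : ℝ → ℝ) (x : ℝ) : ℝ :=
  ∫ z, k z * (P (x + z) - P x)

theorem continuous_of_abs_sub_le {P : ℝ → ℝ} {C : ℝ} (hP : ∀ x y, |P x - P y| ≤ C * |x - y|) :
    Continuous P := by
  have : LipschitzWith C.toNNReal P := LipschitzWith.of_dist_le_mul fun x y => by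
    rw [Real.dist_eq, Real.dist_eq]
    exact (hP x y).trans (by gcongr; exact Real.le_coe_toNNReal C)
  exact this.continuous

theorem nonneg_of_abs_sub_le {P : ℝ → ℝ} {C : ℝ} (hP : ∀ x y, |P x - P y| ≤ C * |x - y|) :
    0 ≤ C := by
  have := (abs_nonneg _).trans (hP 1 0)
  simpa using this

namespace IsDecreasingKernel

variable {k : ℝ → ℝ}

theorem abs_mul_eq (hk : IsDecreasingKernel k) (z : ℝ) : |z| * k z = z * k z := by
  rcases le_or_gt z 0 with h | h
  · rw [hk.eq_zero z h]; simp
  · rw [abs_of_pos h]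

theorem integral_nonneg (hk : IsDecreasingKernel k) : 0 ≤ ∫ z, k z :=
  MeasureTheory.integral_nonneg hk.nonneg

theorem integrable_mul_of_bound (hk : IsDecreasingKernel k) {g : ℝ → ℝ} {M : ℝ}
    (hg : Continuous g) (hM : ∀ z, |g z| ≤ M) : Integrable fun z => k z * g z :=
  hk.integrable.mul_bdd hg.aestronglyMeasurable (ae_of_all _ hM)

theorem integrable_average (hk : IsDecreasingKernel k) {P : ℝ → ℝ} {C : ℝ}
    (hP : ∀ x y, |P x - P y| ≤ C * |x - y|) (x : ℝ) :
    Integrable fun z => k z * (P (x + z) - P x) := by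
  have hc := continuous_of_abs_sub_le hP
  refine (hk.integrable_mul.const_mul C).mono' ?_ (ae_of_all _ fun z => ?_)
  · exact hk.integrable.aestronglyMeasurable.mul (by fun_prop)
  · rw [Real.norm_eq_abs, abs_mul, abs_of_nonneg (hk.nonneg z), ← hk.abs_mul_eq]
    have := mul_le_mul_of_nonneg_left (hP (x + z) x) (hk.nonneg z)
    rw [add_sub_cancel_left] at this
    linarith

theorem abs_average_le (hk : IsDecreasingKernel k) {P : ℝ → ℝ} {C : ℝ}
    (hP : ∀ x y, |P x - P y| ≤ C * |x - y|) (x : ℝ) : |potentialAverage k P x| ≤ C := by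
  have := norm_integral_le_of_norm_le (hk.integrable_mul.const_mul C)
    (f := fun z => k z * (P (x + z) - P x)) (ae_of_all _ fun z => by
    rw [Real.norm_eq_abs, abs_mul, abs_of_nonneg (hk.nonneg z), ← hk.abs_mul_eq]
    have := mul_le_mul_of_nonneg_left (hP (x + z) x) (hk.nonneg z)
    rw [add_sub_cancel_left] at this
    linarith)
  rw [integral_const_mul, hk.mass, mul_one] at this
  exact this

theorem average_nonneg (hk : IsDecreasingKernel k) {P : ℝ → ℝ} (hP : Monotone P) (x : ℝ) :
    0 ≤ potentialAverage k P x := by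
  refine MeasureTheory.integral_nonneg fun z => ?_
  rcases le_or_gt z 0 with h | h
  · simp [hk.eq_zero z h]
  · exact mul_nonneg (hk.nonneg z) (sub_nonneg.2 (hP (by linarith)))

/-- Stability of the average under perturbations of the potential and of the base point. -/
theorem abs_average_sub_average_le (hk : IsDecreasingKernel k) {P Q : ℝ → ℝ} {C C' β : ℝ}
    (hP : ∀ x y, |P x - P y| ≤ C * |x - y|) (hQ : ∀ x y, |Q x - Q y| ≤ C' * |x - y|)
    {x y : ℝ} (h : ∀ z, |P (x + z) - Q (y + z)| ≤ β) :
    |potentialAverage k P x - potentialAverage k Q y| ≤ 2 * β * ∫ z, k z := by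
  rw [potentialAverage, potentialAverage,
    ← integral_sub (hk.integrable_average hP x) (hk.integrable_average hQ y)]
  rw [← integral_const_mul (2 * β), ← Real.norm_eq_abs]
  refine norm_integral_le_of_norm_le (hk.integrable.const_mul _) (ae_of_all _ fun z => ?_)
  rw [Real.norm_eq_abs, ← mul_sub, abs_mul, abs_of_nonneg (hk.nonneg z), mul_comm]
  gcongr
  · exact hk.nonneg z
  have h0 := h 0
  have hz := h z
  simp only [add_zero] at h0
  rw [abs_le] at *
  constructor <;> linarith [h0.1, h0.2, hz.1, hz.2]

theorem abs_average_sub_le (hk : IsDecreasingKernel k) {P : ℝ → ℝ} {C : ℝ}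
    (hP : ∀ x y, |P x - P y| ≤ C * |x - y|) (x y : ℝ) :
    |potentialAverage k P x - potentialAverage k P y| ≤ (2 * C * ∫ z, k z) * |x - y| := by
  have := hk.abs_average_sub_average_le hP hP (x := x) (y := y) (β := C * |x - y|)
    (fun z => by simpa using hP (x + z) (y + z))
  linarith

theorem integrable_defect (hk : IsDecreasingKernel k) {P f : ℝ → ℝ} {C h F : ℝ}
    (hP : ∀ x y, |P x - P y| ≤ C * |x - y|) (hf : Continuous f) (hF : ∀ x, |f x| ≤ F)
    (hh : 0 ≤ h) (x : ℝ) :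
    Integrable fun y => k (y - x) * (P (y - h * f y) - P (y - h * f x)) := by
  have hc := continuous_of_abs_sub_le hP
  have h1 : Integrable fun z => k z * (P (x + z - h * f (x + z)) - P (x + z - h * f x)) := by
    refine hk.integrable_mul_of_bound (M := C * (h * (2 * F))) (by fun_prop) fun z => ?_
    refine (hP _ _).trans ?_
    have hC := nonneg_of_abs_sub_le hP
    gcongr
    rw [show x + z - h * f (x + z) - (x + z - h * f x) = h * (f x - f (x + z)) by ring,
      abs_mul, abs_of_nonneg hh]
    gcongr
    have := abs_sub (f x) (f (x + z))
    linarith [hF x, hF (x + z)]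
  have h2 := h1.comp_sub_right x
  simpa using h2

/-- One backward Euler step for the average of a transported potential. -/
theorem abs_average_step_le (hk : IsDecreasingKernel k) {P Q f : ℝ → ℝ} {C h F β : ℝ}
    (hP : ∀ x y, |P x - P y| ≤ C * |x - y|) (hQ : ∀ x y, |Q x - Q y| ≤ C * |x - y|)
    (hf : Continuous f) (hF : ∀ x, |f x| ≤ F) (hh : 0 ≤ h)
    (hPQ : ∀ x, |Q x - P (x - h * f x)| ≤ β) (x : ℝ) :
    |potentialAverage k Q x - potentialAverage k P (x - h * f x)
      - ∫ y, k (y - x) * (P (y - h * f y) - P (y - h * f x))| ≤ 2 * β * ∫ z, k z := by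
  have hd := hk.integrable_defect hP hf hF hh x
  rw [← integral_add_left_eq_self _ x]
  have hd' := hd.comp_add_left x
  simp only [add_sub_cancel_left] at hd' ⊢
  rw [potentialAverage, potentialAverage,
    ← integral_sub (hk.integrable_average hQ x) (hk.integrable_average hP _),
    ← integral_sub (by exact (hk.integrable_average hQ x).sub (hk.integrable_average hP _)) hd',
    ← integral_const_mul (2 * β), ← Real.norm_eq_abs]
  refine norm_integral_le_of_norm_le (hk.integrable.const_mul _) (ae_of_all _ fun z => ?_)
  -- After the foot value and the defect are removed, only the step errors at `x + z` and at `x`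
  -- remain, whence the factor `2 * β`.
  have e : k z * (Q (x + z) - Q x) - k z * (P (x - h * f x + z) - P (x - h * f x))
      - k z * (P (x + z - h * f (x + z)) - P (x + z - h * f x))
      = k z * ((Q (x + z) - P (x + z - h * f (x + z))) - (Q x - P (x - h * f x))) := by
    rw [show x - h * f x + z = x + z - h * f x by ring]; ring
  rw [e, Real.norm_eq_abs, abs_mul, abs_of_nonneg (hk.nonneg z), mul_comm]
  gcongr
  · exact hk.nonneg z
  have h0 := hPQ x
  have hz := hPQ (x + z)
  rw [abs_le] at *
  constructor <;> linarith [h0.1, h0.2, hz.1, hz.2]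

end IsDecreasingKernel

/-! ### Transported potentials: order, maximum principle, decay of alternating sums. -/

/-- A potential `U(t, x)` of a density transported with speed `V(w)`, where `w` is the nonlocal
average of the density; the transport is encoded by the consistency of backward Euler steps. -/
structure IsTransportedPotential (V k : ℝ → ℝ) (C B : ℝ) (U : ℝ → ℝ → ℝ) : Prop where
  lip : ∀ t, 0 ≤ t → ∀ x y, |U t x - U t y| ≤ C * |x - y|
  -- The speed is evaluated at the arrival time `t + h`, which allows extremal points to be chosen
  -- for the average at `t + h` and then traced back.
  step : ∀ t h, 0 ≤ t → 0 < h → h ≤ 1 → ∀ x,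
    |U (t + h) x - U t (x - h * V (potentialAverage k (U (t + h)) x))| ≤ B * h ^ 2
  mono_zero : Monotone (U 0)
  lip_zero : ∀ x y, |U 0 x - U 0 y| ≤ 1 * |x - y|

namespace IsTransportedPotential

variable {V k : ℝ → ℝ} {C B : ℝ} {U : ℝ → ℝ → ℝ} {L : ℝ}

theorem nonneg_const (hU : IsTransportedPotential V k C B U) : 0 ≤ C :=
  nonneg_of_abs_sub_le (hU.lip 0 le_rfl)

theorem nonneg_err (hU : IsTransportedPotential V k C B U) : 0 ≤ B := by
  simpa using (abs_nonneg _).trans (hU.step 0 1 le_rfl one_pos le_rfl 0)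

theorem abs_speed_sub_le (hU : IsTransportedPotential V k C B U) (hk : IsDecreasingKernel k)
    (hL : 0 ≤ L) (hV : ∀ a b, |V a - V b| ≤ L * |a - b|) {t : ℝ} (ht : 0 ≤ t) (x y : ℝ) :
    |V (potentialAverage k (U t) x) - V (potentialAverage k (U t) y)|
      ≤ (L * (2 * C * ∫ z, k z)) * |x - y| := by
  rw [mul_assoc]
  exact (hV _ _).trans (mul_le_mul_of_nonneg_left (hk.abs_average_sub_le (hU.lip t ht) x y) hL)

theorem abs_speed_le (hU : IsTransportedPotential V k C B U) (hk : IsDecreasingKernel k)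
    (hL : 0 ≤ L) (hV : ∀ a b, |V a - V b| ≤ L * |a - b|) {t : ℝ} (ht : 0 ≤ t) (x : ℝ) :
    |V (potentialAverage k (U t) x)| ≤ |V 0| + L * C := by
  have h1 := hV (potentialAverage k (U t) x) 0
  rw [sub_zero] at h1
  have h2 := mul_le_mul_of_nonneg_left (hk.abs_average_le (hU.lip t ht) x) hL
  have h3 := abs_sub_abs_le_abs_sub (V (potentialAverage k (U t) x)) (V 0)
  linarith

/-- Time steps below this size make the backward Euler foot map monotone. -/
theorem exists_monotone_foot (hU : IsTransportedPotential V k C B U) (hk : IsDecreasingKernel k)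
    (hL : 0 ≤ L) (hV : ∀ a b, |V a - V b| ≤ L * |a - b|) :
    ∃ h₀, 0 < h₀ ∧ h₀ ≤ 1 ∧ ∀ t h, 0 ≤ t → 0 < h → h ≤ h₀ →
      Monotone fun x => x - h * V (potentialAverage k (U t) x) := by
  set Λ := L * (2 * C * ∫ z, k z) with hΛ
  have hΛ0 : 0 ≤ Λ := by
    have := hU.nonneg_const
    have := hk.integral_nonneg
    positivity
  -- `Λ` is a Lipschitz constant of the speed in space, so `h * Λ ≤ 1` keeps the foot map
  -- non-decreasing.
  refine ⟨1 / (1 + Λ), by positivity, by rw [div_le_one (by positivity)]; linarith, ?_⟩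
  intro t h ht hh hh0 x y hxy
  have h1 := hU.abs_speed_sub_le hk hL hV ht y x
  rw [← hΛ, abs_of_nonneg (sub_nonneg.2 hxy)] at h1
  have h2 := (abs_le.1 h1).2
  rw [le_div_iff₀ (by positivity)] at hh0
  have h3 : h * Λ ≤ 1 := by nlinarith
  have h4 := mul_le_mul_of_nonneg_left h2 hh.le
  have h5 := mul_le_mul_of_nonneg_right h3 (sub_nonneg.2 hxy)
  simp only
  nlinarith

/-- Up to `O(h²)`, one step composes the potential with the non-decreasing foot map, so order is
lost only by a total that vanishes with `h`. This supplies the nonnegativity of the density, which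
is not assumed at positive times. -/
theorem monotone (hU : IsTransportedPotential V k C B U) (hk : IsDecreasingKernel k)
    (hL : 0 ≤ L) (hV : ∀ a b, |V a - V b| ≤ L * |a - b|) {t : ℝ} (ht : 0 ≤ t) :
    Monotone (U t) := by
  obtain ⟨h₀, hh₀, hh₁, hfoot⟩ := hU.exists_monotone_foot hk hL hV
  have hB := hU.nonneg_err
  intro x y hxy
  refine le_of_forall_pos_le_add fun δ hδ => ?_
  have := forall_of_step (p := fun t e => ∀ x y, x ≤ y → U t x ≤ U t y + e) (A := 0) (B := 2 * B)
    le_rfl (by positivity) hh₀ (fun t e e' H he x y hxy => (H x y hxy).trans (by linarith))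
    (fun x y hxy => by simpa using hU.mono_zero hxy) (fun t h e ht hh hhle he H x y hxy => by
      have h1 := H _ _ (hfoot (t + h) h (by positivity) hh hhle hxy)
      have h2 := abs_le.1 (hU.step t h ht hh (hhle.trans hh₁) x)
      have h3 := abs_le.1 (hU.step t h ht hh (hhle.trans hh₁) y)
      simp only at h1
      linarith [h2.2, h3.1]) ht hδ
  exact this x y hxy

end IsTransportedPotential

namespace IsTransportedPotential

variable {V k : ℝ → ℝ} {C B : ℝ} {U : ℝ → ℝ → ℝ} {L : ℝ}

/-- A discrete maximum principle. Where the average exceeds `1`, the speed is, up to the excess `m`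
itself, no larger than anywhere else; the defect is then at most of order `h * m`, and Grönwall
closes the argument. The Lipschitz constant `C` of the potential may exceed `1`, so it does not give
this bound directly. -/
theorem average_le_one (hU : IsTransportedPotential V k C B U) (hk : IsDecreasingKernel k)
    (hL : 0 ≤ L) (hV : ∀ a b, |V a - V b| ≤ L * |a - b|) (hanti : AntitoneOn V (Icc 0 1))
    {t : ℝ} (ht : 0 ≤ t) (x : ℝ) : potentialAverage k (U t) x ≤ 1 := by
  obtain ⟨h₀, hh₀, hh₁, hfoot⟩ := hU.exists_monotone_foot hk hL hV
  have hB := hU.nonneg_err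
  have hC := hU.nonneg_const
  set K := ∫ z, k z with hK
  have hK0 : 0 ≤ K := hk.integral_nonneg
  set A := 2 * K * C * L with hA
  have hA0 : 0 ≤ A := by positivity
  refine le_of_forall_pos_le_add fun δ hδ => ?_
  refine forall_of_step (p := fun t e => ∀ x, potentialAverage k (U t) x ≤ 1 + e) (A := 2 * A)
    (B := 4 * B * K) (h₀ := min h₀ (1 / (2 * A + 1))) (by positivity) (by positivity)
    (by positivity) (fun t e e' H he x => (H x).trans (by linarith))
    (fun x => by simpa using (abs_le.1 (hk.abs_average_le hU.lip_zero x)).2)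
    (fun t h e ht hh hhle he H => ?_) ht hδ x
  have hh0 := hhle.trans (min_le_left _ _)
  have hhA : A * h ≤ 1 / 2 := by
    have := hhle.trans (min_le_right _ _)
    rw [le_div_iff₀ (by positivity)] at this
    nlinarith
  have hT : 0 ≤ t + h := by positivity
  set W := potentialAverage k (U (t + h)) with hW
  have hW0 : ∀ x, 0 ≤ W x := hk.average_nonneg (hU.monotone hk hL hV hT)
  have hWC : ∀ x, W x ≤ C := fun x => (abs_le.1 (hk.abs_average_le (hU.lip _ hT) x)).2
  have hbdd : BddAbove (range fun x => max (W x - 1) 0) :=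
    ⟨C, by rintro _ ⟨x, rfl⟩; exact max_le (by linarith [hWC x]) hC⟩
  set m := ⨆ x, max (W x - 1) 0 with hm
  have hmx : ∀ x, W x - 1 ≤ m := fun x => (le_max_left _ _).trans (le_ciSup hbdd x)
  have hm0 : 0 ≤ m := (le_max_right _ _).trans (le_ciSup hbdd 0)
  have hf : Continuous fun x => V (W x) :=
    continuous_of_abs_sub_le (hU.abs_speed_sub_le hk hL hV hT)
  have main : m ≤ e + 2 * B * h ^ 2 * K + A * h * m := by
    refine ciSup_le fun x => max_le ?_ (by positivity)
    rcases le_or_gt (W x) 1 with hx | hx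
    · have : 0 ≤ e + 2 * B * h ^ 2 * K + A * h * m := by positivity
      linarith
    -- Both speeds are compared with `V 1`: monotonicity of `V` is used only where `W y ≤ 1`, and
    -- above `1` the Lipschitz bound costs `L * m` on each side.
    have hfx : ∀ y, V (W x) ≤ V (W y) + 2 * L * m := by
      intro y
      have h1 : V (W x) ≤ V 1 + L * m := by
        have h2 := (abs_le.1 (hV (W x) 1)).2
        rw [abs_of_pos (sub_pos.2 hx)] at h2
        have h3 := mul_le_mul_of_nonneg_left (hmx x) hL
        linarith
      have h4 : 0 ≤ L * m := by positivity
      rcases le_or_gt (W y) 1 with hy | hy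
      · have := hanti ⟨hW0 y, hy⟩ ⟨zero_le_one, le_rfl⟩ hy
        linarith
      · have h2 := (abs_le.1 (hV (W y) 1)).1
        rw [abs_of_pos (sub_pos.2 hy)] at h2
        have h3 := mul_le_mul_of_nonneg_left (hmx y) hL
        linarith
    have h1 := hk.abs_average_step_le (hU.lip t ht) (hU.lip _ hT) hf
      (hU.abs_speed_le hk hL hV hT) hh.le
      (fun x => hU.step t h ht hh (hh0.trans hh₁) x) x
    have h2 : ∫ y, k (y - x) * (U t (y - h * V (W y)) - U t (y - h * V (W x)))
        ≤ ∫ y, (C * (h * (2 * L * m))) * k (y - x) := by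
      refine integral_mono (hk.integrable_defect (hU.lip t ht) hf
        (hU.abs_speed_le hk hL hV hT) hh.le x) ((hk.integrable.comp_sub_right x).const_mul _)
        fun y => ?_
      simp only
      rw [mul_comm (C * _)]
      refine mul_le_mul_of_nonneg_left ?_ (hk.nonneg _)
      have h3 : y - h * V (W y) ≤ y - h * V (W x) + h * (2 * L * m) := by
        have := mul_le_mul_of_nonneg_left (hfx y) hh.le
        linarith
      have h4 := hU.monotone hk hL hV ht h3
      have h5 := (abs_le.1 (hU.lip t ht (y - h * V (W x) + h * (2 * L * m))
        (y - h * V (W x)))).2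
      rw [add_sub_cancel_left, abs_of_nonneg (show 0 ≤ h * (2 * L * m) by positivity)] at h5
      linarith
    rw [integral_const_mul, integral_sub_right_eq_self k x, ← hK] at h2
    have h3 := (abs_le.1 h1).2
    have h4 := H (x - h * V (W x))
    have h5 : C * (h * (2 * L * m)) * K = A * h * m := by rw [hA]; ring
    have h6 : 2 * (B * h ^ 2) * ∫ z, k z = 2 * B * h ^ 2 * K := by rw [hK]; ring
    rw [← hW] at h3
    linarith
  intro x
  have h1 := hmx x
  have h3 : 0 ≤ B * h ^ 2 * K := by positivity
  -- The term `A * h * m` is absorbed using `A * h ≤ 1 / 2`, which gives `1 / (1 - A h) ≤ 1 + 2 A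
  -- h`.
  have h2 : m ≤ (1 + 2 * (A * h)) * (e + 2 * B * h ^ 2 * K) := by
    have h0 : 0 ≤ A * h := by positivity
    have h5 : m * (1 - A * h) ≤ e + 2 * B * h ^ 2 * K := by linarith
    have h6 : 1 ≤ (1 - A * h) * (1 + 2 * (A * h)) := by nlinarith
    calc m ≤ m * ((1 - A * h) * (1 + 2 * (A * h))) := le_mul_of_one_le_right hm0 h6
      _ = (1 + 2 * (A * h)) * (m * (1 - A * h)) := by ring
      _ ≤ _ := mul_le_mul_of_nonneg_left h5 (by positivity)
  have h4 : 2 * (A * h) * (2 * B * h ^ 2 * K) ≤ 1 * (2 * B * h ^ 2 * K) :=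
    mul_le_mul_of_nonneg_right (by linarith) (by linarith)
  linarith

/-- Alternating sums of the average along non-increasing sequences cannot grow in time. -/
theorem alternating_sum_le (hU : IsTransportedPotential V k C B U) (hk : IsDecreasingKernel k)
    (hL : 0 ≤ L) (hV : ∀ a b, |V a - V b| ≤ L * |a - b|) (hanti : AntitoneOn V (Icc 0 1))
    {σ : ℝ} (hσ : σ = 1 ∨ σ = -1) (N : ℕ) {D : ℝ}
    (hD : ∀ x : ℕ → ℝ, Antitone x →
      ∑ i ∈ Finset.range (N + 1), σ * (-1) ^ i * potentialAverage k (U 0) (x i) ≤ D)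
    {t : ℝ} (ht : 0 ≤ t) {x : ℕ → ℝ} (hx : Antitone x) :
    ∑ i ∈ Finset.range (N + 1), σ * (-1) ^ i * potentialAverage k (U t) (x i) ≤ D := by
  obtain ⟨h₀, hh₀, hh₁, hfoot⟩ := hU.exists_monotone_foot hk hL hV
  have hB := hU.nonneg_err
  have hC := hU.nonneg_const
  set K := ∫ z, k z with hK
  have hK0 : 0 ≤ K := hk.integral_nonneg
  have hsgn : ∀ i : ℕ, σ * (-1) ^ i = 1 ∨ σ * (-1) ^ i = -1 := by
    intro i
    rcases hσ with rfl | rfl <;> rcases neg_one_pow_eq_or ℝ i with h | h <;> simp [h]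
  have habs : ∀ i : ℕ, |σ * (-1) ^ i| = 1 := fun i => by
    rcases hsgn i with h | h <;> simp [h]
  refine le_of_forall_pos_le_add fun δ hδ => ?_
  -- The three parts of the error constant come from the defects, from the consistency error of the
  -- step, and from the use of a near-maximiser.
  refine forall_of_step (p := fun t e => ∀ x : ℕ → ℝ, Antitone x →
      ∑ i ∈ Finset.range (N + 1), σ * (-1) ^ i * potentialAverage k (U t) (x i) ≤ D + e)
    (A := 0) (B := (N + 1) * (C * L) * ((N + 1) * K) + (N + 1) * (2 * B * K) + 1)
    le_rfl (by positivity) hh₀ (fun t e e' H he x hx => (H x hx).trans (by linarith))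
    (fun x hx => by simpa using hD x hx) (fun t h e ht hh hhle he H => ?_) ht hδ x hx
  have hh1 : h ≤ 1 := hhle.trans hh₁
  have hT : 0 ≤ t + h := by positivity
  set W := potentialAverage k (U (t + h)) with hW
  have hW0 : ∀ x, W x ∈ Icc (0 : ℝ) 1 := fun x =>
    ⟨hk.average_nonneg (hU.monotone hk hL hV hT) x, hU.average_le_one hk hL hV hanti hT x⟩
  set S : (ℕ → ℝ) → ℝ := fun x => ∑ i ∈ Finset.range (N + 1), σ * (-1) ^ i * W (x i) with hS
  have hSle : ∀ x, S x ≤ N + 1 := fun x => by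
    calc S x ≤ ∑ i ∈ Finset.range (N + 1), (1 : ℝ) := by
          refine Finset.sum_le_sum fun i _ => (le_abs_self _).trans ?_
          rw [abs_mul, habs, one_mul, abs_of_nonneg (hW0 _).1]
          exact (hW0 _).2
      _ = _ := by simp
  have hbdd : BddAbove (S '' {x | Antitone x}) :=
    ⟨N + 1, by rintro _ ⟨x, _, rfl⟩; exact hSle x⟩
  -- The supremum need not be attained, as points may escape to infinity; a loss of `h ^ 2` is
  -- harmless in the Grönwall argument.
  obtain ⟨_, ⟨x, hx, rfl⟩, hxm⟩ := exists_lt_of_lt_csSup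
    (⟨_, fun _ => (0 : ℝ), antitone_const, rfl⟩ : (S '' {x | Antitone x}).Nonempty)
    (sub_lt_self (sSup (S '' {x | Antitone x})) (show 0 < h ^ 2 by positivity))
  have hmax : ∀ z, Antitone z → S z ≤ S x + h ^ 2 := fun z hz => by
    have := le_csSup hbdd ⟨z, hz, rfl⟩
    linarith
  have hx' : Antitone x := hx
  have hf : Continuous fun x => V (W x) :=
    continuous_of_abs_sub_le (hU.abs_speed_sub_le hk hL hV hT)
  -- Moving the single point `x j` right to `y` without passing its predecessors keeps the sequence
  -- admissible, so it gains at most `h ^ 2`.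
  have hmove : ∀ j ≤ N, ∀ y, x j ≤ y → (∀ i < j, y ≤ x i) →
      σ * (-1) ^ j * (W y - W (x j)) ≤ h ^ 2 := by
    intro j hj y hy hyi
    have hz : Antitone (Function.update x j y) := by
      intro a b hab
      rcases eq_or_ne b j with rfl | hb <;> rcases eq_or_ne a b with rfl | ha
      · exact le_rfl
      · rw [Function.update_self, Function.update_of_ne ha]
        exact hyi a (lt_of_le_of_ne hab ha)
      · exact le_rfl
      · rw [Function.update_of_ne hb]
        rcases eq_or_ne a j with rfl | ha
        · rw [Function.update_self]; exact (hx' hab).trans hy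
        · rw [Function.update_of_ne ha]; exact hx' hab
    have h1 := hmax _ hz
    have h2 : S (Function.update x j y) - S x = σ * (-1) ^ j * (W y - W (x j)) := by
      rw [hS]
      simp only
      rw [← Finset.sum_sub_distrib, Finset.sum_eq_single j]
      · rw [Function.update_self]; ring
      · intro b _ hb
        rw [Function.update_of_ne hb]; ring
      · intro hj'
        exact absurd (Finset.mem_range.2 (by omega)) hj'
    linarith
  -- `r ↦ U t (y - h * V r)` is non-decreasing on `[0, 1]` with Lipschitz constant `C * h * L ≤ C *
  -- L`, so a one-sided bound on the averages passes to the potentials.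
  have hshift : ∀ s : ℝ, (s = 1 ∨ s = -1) → ∀ a b y, s * (W a - W b) ≤ h ^ 2 →
      s * (U t (y - h * V (W a)) - U t (y - h * V (W b))) ≤ C * L * h ^ 2 := by
    intro s hs a b y hab
    have hmono := hU.monotone hk hL hV ht
    have hCL : 0 ≤ C * L * h ^ 2 := by positivity
    have key : ∀ a b, W a ≤ W b + h ^ 2 →
        U t (y - h * V (W a)) - U t (y - h * V (W b)) ≤ C * L * h ^ 2 := by
      intro a b hab
      rcases le_total (W a) (W b) with hle | hle
      · have h1 := hanti (hW0 a) (hW0 b) hle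
        have h2 : U t (y - h * V (W a)) ≤ U t (y - h * V (W b)) := by
          apply hmono
          have := mul_le_mul_of_nonneg_left h1 hh.le
          linarith
        linarith
      · have h1 := (le_abs_self _).trans (hU.lip t ht (y - h * V (W a)) (y - h * V (W b)))
        have h2 : |y - h * V (W a) - (y - h * V (W b))| ≤ L * h ^ 2 := by
          rw [show y - h * V (W a) - (y - h * V (W b)) = h * (V (W b) - V (W a)) by ring, abs_mul,
            abs_of_pos hh]
          have h3 := hV (W b) (W a)
          rw [abs_sub_comm (W b), abs_of_nonneg (sub_nonneg.2 hle)] at h3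
          calc h * |V (W b) - V (W a)| ≤ 1 * |V (W b) - V (W a)| := by gcongr
            _ ≤ L * (W a - W b) := by linarith
            _ ≤ _ := by gcongr; linarith
        calc _ ≤ _ := h1
          _ ≤ C * (L * h ^ 2) := by gcongr
          _ = _ := by ring
    rcases hs with rfl | rfl
    · have := key a b (by linarith)
      linarith
    · have := key b a (by linarith)
      linarith
  have hstep : ∀ a, |W a - potentialAverage k (U t) (a - h * V (W a))
      - ∫ y, k (y - a) * (U t (y - h * V (W y)) - U t (y - h * V (W a)))|
        ≤ 2 * B * K * h ^ 2 := fun a => by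
    have := hk.abs_average_step_le (hU.lip t ht) (hU.lip _ hT) hf
      (hU.abs_speed_le hk hL hV hT) hh.le (fun x => hU.step t h ht hh hh1 x) a
    calc _ ≤ _ := this
      _ = _ := by rw [hK]; ring
  have hint : ∀ a, Integrable fun y =>
      k (y - a) * (U t (y - h * V (W y)) - U t (y - h * V (W a))) := fun a =>
    hk.integrable_defect (hU.lip t ht) hf (hU.abs_speed_le hk hL hV hT) hh.le a
  have hdef : ∑ i ∈ Finset.range (N + 1), σ * (-1) ^ i *
      ∫ y, k (y - x i) * (U t (y - h * V (W y)) - U t (y - h * V (W (x i))))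
        ≤ (N + 1) * (C * L * h ^ 2) * ((N + 1) * K) := by
    have e1 : ∑ i ∈ Finset.range (N + 1), ∫ y, k (y - x i) = (N + 1) * K := by
      simp_rw [integral_sub_right_eq_self k]
      simp [hK]
    rw [← e1, ← integral_finsetSum _ fun i _ => hk.integrable.comp_sub_right (x i),
      ← integral_const_mul]
    simp_rw [← integral_const_mul]
    rw [← integral_finsetSum _ fun i _ => (hint (x i)).const_mul _]
    refine integral_mono (integrable_finsetSum _ fun i _ => (hint (x i)).const_mul _)
      ((integrable_finsetSum _ fun i _ => hk.integrable.comp_sub_right (x i)).const_mul _)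
      fun y => ?_
    -- For fixed `y`, the two sign conditions come from moving the first point left of `y` up to
    -- `y`, and from moving `x (i + 1)` up to `x i`.
    refine sum_alternating_weighted_le (by positivity) hx' (fun i => hk.nonneg _)
      (fun i hi => hk.eq_zero _ (by linarith))
      (fun i hi => hk.antitoneOn (mem_Ioi.2 (sub_pos.2 hi))
        (mem_Ioi.2 (sub_pos.2 ((hx' i.le_succ).trans_lt hi))) (by linarith [hx' i.le_succ]))
      (fun j hj hjy hij => hshift _ (hsgn j) _ _ _ (hmove j hj y hjy.le hij)) ?_
    intro i hi
    rw [sub_sub_sub_cancel_left]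
    exact hshift _ (hsgn (i + 1)) _ _ _ (hmove (i + 1) hi (x i) (hx' i.le_succ)
      fun l hl => hx' (by omega))
  have hSx : S x ≤ D + e + (N + 1) * (C * L * h ^ 2) * ((N + 1) * K)
      + (N + 1) * (2 * B * K * h ^ 2) := by
    -- The feet of a non-increasing sequence are again non-increasing, so the bound at time `t`
    -- applies to them.
    have h1 := H (fun i => x i - h * V (W (x i)))
      ((hfoot (t + h) h hT hh hhle).comp_antitone hx')
    have h2 : ∀ i ∈ Finset.range (N + 1), σ * (-1) ^ i * W (x i)
        ≤ σ * (-1) ^ i * potentialAverage k (U t) (x i - h * V (W (x i)))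
        + σ * (-1) ^ i * (∫ y, k (y - x i) * (U t (y - h * V (W y)) - U t (y - h * V (W (x i)))))
        + 2 * B * K * h ^ 2 := by
      intro i _
      have h3 := hstep (x i)
      rw [← one_mul |_ - _ - _|, ← habs i, ← abs_mul] at h3
      have h4 := (le_abs_self _).trans h3
      linarith
    have h3 := Finset.sum_le_sum h2
    rw [Finset.sum_add_distrib, Finset.sum_add_distrib] at h3
    simp only [Finset.sum_const, Finset.card_range, nsmul_eq_mul] at h3
    push_cast at h3
    simp only [hS]
    linarith
  intro z hz
  have := hmax z hz
  simp only [hS] at this hSx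
  linarith

end IsTransportedPotential

/-! ### Alternating sums and pointwise variation. -/

/-- Doubling lets every interior value enter two neighbouring increments and leaves one copy of each
end value; the limits at `±∞` later compensate for these. -/
theorem two_mul_sum_alternating (σ : ℝ) (w : ℕ → ℝ) (N : ℕ) :
    2 * ∑ i ∈ Finset.range (N + 1), σ * (-1) ^ i * w i
      = ∑ i ∈ Finset.range N, σ * (-1) ^ i * (w i - w (i + 1)) + σ * w 0 + σ * (-1) ^ N * w N := by
  induction N with
  | zero => simp; ring
  | succ N ih =>
    rw [Finset.sum_range_succ, mul_add, ih, Finset.sum_range_succ (n := N), pow_succ]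
    ring

theorem sum_edist_eq_ofReal (f : ℝ → ℝ) (u : ℕ → ℝ) (n : ℕ) :
    ∑ i ∈ Finset.range n, edist (f (u (i + 1))) (f (u i))
      = ENNReal.ofReal (∑ i ∈ Finset.range n, |f (u (i + 1)) - f (u i)|) := by
  rw [ENNReal.ofReal_sum_of_nonneg fun i _ => abs_nonneg _]
  refine Finset.sum_congr rfl fun i _ => ?_
  rw [edist_dist, Real.dist_eq]

theorem sum_abs_sub_reflect (f : ℝ → ℝ) (u : ℕ → ℝ) (n : ℕ) :
    ∑ i ∈ Finset.range n, |f (u (n - i)) - f (u (n - (i + 1)))|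
      = ∑ i ∈ Finset.range n, |f (u (i + 1)) - f (u i)| := by
  rw [← Finset.sum_range_reflect]
  refine Finset.sum_congr rfl fun i hi => ?_
  have := Finset.mem_range.1 hi
  rw [show n - (n - 1 - i) = i + 1 by omega, show n - (n - 1 - i + 1) = i by omega]

theorem sum_abs_sub_le_of_antitone {f : ℝ → ℝ} (hf : eVariationOn f univ ≠ ⊤) {z : ℕ → ℝ}
    (hz : Antitone z) (n : ℕ) :
    ∑ i ∈ Finset.range n, |f (z i) - f (z (i + 1))| ≤ (eVariationOn f univ).toReal := by
  have hu : Monotone fun i => z (n - i) := fun a b hab => hz (by omega)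
  have h1 := eVariationOn.sum_le (f := f) (s := univ) (n := n) hu fun i => mem_univ _
  rw [sum_edist_eq_ofReal f (fun i => z (n - i)) n] at h1
  have h2 := sum_abs_sub_reflect f (fun i => z (n - i)) n
  have h3 := (ENNReal.ofReal_le_iff_le_toReal hf).1 h1
  rw [← h2] at h3
  refine le_trans (le_of_eq (Finset.sum_congr rfl fun i hi => ?_)) h3
  have := Finset.mem_range.1 hi
  rw [show n - (n - i) = i by omega, show n - (n - (i + 1)) = i + 1 by omega]

theorem abs_sign_eq_one {σ : ℝ} (hσ : σ = 1 ∨ σ = -1) : |σ| = 1 := by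
  rcases hσ with rfl | rfl <;> simp

/-- Alternating sums of a function of bounded variation, with its limits at `±∞`. -/
theorem two_mul_sum_alternating_le {f : ℝ → ℝ} (hf : eVariationOn f univ ≠ ⊤) {a b : ℝ}
    (ha : Tendsto f atTop (𝓝 a)) (hb : Tendsto f atBot (𝓝 b)) {σ : ℝ} (hσ : σ = 1 ∨ σ = -1)
    (N : ℕ) {x : ℕ → ℝ} (hx : Antitone x) :
    2 * ∑ i ∈ Finset.range (N + 1), σ * (-1) ^ i * f (x i)
      ≤ (eVariationOn f univ).toReal + σ * a + σ * (-1) ^ N * b := by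
  have key : ∀ X Y, x 0 ≤ X → Y ≤ x N →
      2 * ∑ i ∈ Finset.range (N + 1), σ * (-1) ^ i * f (x i)
        ≤ (eVariationOn f univ).toReal + σ * f X + σ * (-1) ^ N * f Y := by
    intro X Y hX hY
    -- The sequence is framed by a point `X` on the right and a point `Y` on the left, which are
    -- then sent to `±∞`.
    set z : ℕ → ℝ := fun i => if i = 0 then X else if i ≤ N + 1 then x (i - 1) else Y with hz
    have hza : Antitone z := by
      refine antitone_nat_of_succ_le fun i => ?_
      rcases Nat.eq_zero_or_pos i with rfl | hi
      · simpa [hz] using hX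
      · simp only [hz, Nat.succ_ne_zero, if_false, hi.ne']
        split_ifs with h1 h2 h2
        · exact hx (by omega)
        · omega
        · rw [show i - 1 = N by omega]; exact hY
        · exact le_rfl
    have h1 := sum_abs_sub_le_of_antitone hf hza (N + 2)
    have h2 : ∑ i ∈ Finset.range (N + 2), -σ * (-1) ^ i * (f (z i) - f (z (i + 1)))
        ≤ ∑ i ∈ Finset.range (N + 2), |f (z i) - f (z (i + 1))| := by
      refine Finset.sum_le_sum fun i _ => (le_abs_self _).trans ?_
      rw [abs_mul, abs_mul, abs_neg, abs_sign_eq_one hσ]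
      simp
    have z0 : z 0 = X := by simp [hz]
    have zs : ∀ i ≤ N, z (i + 1) = x i := fun i hi => by simp [hz, hi]
    have zN : z (N + 2) = Y := by simp [hz]
    rw [Finset.sum_range_succ, Finset.sum_range_succ'] at h2
    rw [two_mul_sum_alternating]
    have h3 : ∑ i ∈ Finset.range N, -σ * (-1) ^ (i + 1) * (f (z (i + 1)) - f (z (i + 1 + 1)))
        = ∑ i ∈ Finset.range N, σ * (-1) ^ i * (f (x i) - f (x (i + 1))) := by
      refine Finset.sum_congr rfl fun i hi => ?_
      have := Finset.mem_range.1 hi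
      rw [zs i (by omega), zs (i + 1) (by omega), pow_succ]; ring
    rw [h3, zs N le_rfl, z0, zN, zs 0 (by omega), pow_succ, pow_zero] at h2
    linarith
  have h1 : ∀ Y ≤ x N, 2 * ∑ i ∈ Finset.range (N + 1), σ * (-1) ^ i * f (x i)
        ≤ (eVariationOn f univ).toReal + σ * a + σ * (-1) ^ N * f Y := fun Y hY =>
    ge_of_tendsto (((ha.const_mul σ).const_add _).add_const _)
      ((eventually_ge_atTop (x 0)).mono fun X hX => key X Y hX hY)
  exact ge_of_tendsto ((hb.const_mul _).const_add _)
    ((eventually_le_atBot (x N)).mono fun Y hY => h1 Y hY)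

/-- A bound on alternating sums that allows for prescribed values at `±∞` controls the
variation. -/
theorem eVariationOn_le_of_sum_alternating_le {f : ℝ → ℝ} {a b T : ℝ}
    (H : ∀ σ : ℝ, (σ = 1 ∨ σ = -1) → ∀ (N : ℕ) (x : ℕ → ℝ), Antitone x →
      2 * ∑ i ∈ Finset.range (N + 1), σ * (-1) ^ i * f (x i) ≤ T + σ * a + σ * (-1) ^ N * b) :
    eVariationOn f univ ≤ ENNReal.ofReal T := by
  -- The increments of `y` are absorbed into an alternating sum that keeps only the turning points.
  -- The sign `τ` of the last term is prescribed in advance so that the induction can extend the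
  -- sequence, or leave it unchanged when the next increment has the other sign.
  have claim : ∀ (y : ℕ → ℝ), Antitone y → ∀ (n : ℕ) (τ : ℝ), (τ = 1 ∨ τ = -1) →
      ∃ (σ : ℝ) (N : ℕ) (z : ℕ → ℝ), (σ = 1 ∨ σ = -1) ∧ Antitone z ∧ σ * (-1) ^ N = τ ∧
        (∀ i, y n ≤ z i) ∧
        ∑ i ∈ Finset.range n, |f (y i) - f (y (i + 1))| + τ * f (y n) ≤
          2 * ∑ i ∈ Finset.range (N + 1), σ * (-1) ^ i * f (z i) - σ * a := by
    intro y hy n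
    induction n with
    | zero =>
      intro τ hτ
      rcases le_total 0 (τ * (f (y 0) - a)) with h | h
      · exact ⟨τ, 0, fun _ => y 0, hτ, antitone_const, by simp, fun _ => le_rfl,
          by simp; linarith⟩
      -- A repeated point gives a zero alternating sum, so only the `a` term remains and it has the
      -- favourable sign.
      · refine ⟨-τ, 1, fun _ => y 0, ?_, antitone_const, by simp, fun _ => le_rfl, ?_⟩
        · rcases hτ with rfl | rfl <;> simp
        · simp [Finset.sum_range_succ]; linarith
    | succ n ih =>
      intro τ hτ
      rcases le_total 0 (τ * (f (y (n + 1)) - f (y n))) with h | h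
      · obtain ⟨σ, N, z, hσ, hz, hN, hyz, hle⟩ := ih (-τ) (by rcases hτ with rfl | rfl <;> simp)
        refine ⟨σ, N + 1, fun i => if i ≤ N then z i else y (n + 1), hσ, ?_, ?_, ?_, ?_⟩
        · refine antitone_nat_of_succ_le fun i => ?_
          split_ifs with h1 h2 h2
          · exact hz i.le_succ
          · omega
          · exact (hy n.le_succ).trans (hyz i)
          · exact le_rfl
        · rw [pow_succ, ← mul_assoc, hN]; ring
        · intro i
          beta_reduce
          split_ifs
          · exact (hy n.le_succ).trans (hyz i)
          · exact le_rfl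
        · rw [Finset.sum_range_succ, Finset.sum_range_succ (n := N + 1)]
          have e1 : ∑ i ∈ Finset.range (N + 1), σ * (-1) ^ i *
              f (if i ≤ N then z i else y (n + 1))
              = ∑ i ∈ Finset.range (N + 1), σ * (-1) ^ i * f (z i) :=
            Finset.sum_congr rfl fun i hi => by
              rw [if_pos (by have := Finset.mem_range.1 hi; omega)]
          have e2 : |f (y n) - f (y (n + 1))| = τ * (f (y (n + 1)) - f (y n)) := by
            rw [← abs_of_nonneg h, abs_mul, abs_sign_eq_one hτ, one_mul, abs_sub_comm]
          have e3 : σ * (-1) ^ (N + 1) = τ := by rw [pow_succ, ← mul_assoc, hN]; ring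
          beta_reduce
          rw [e1, e2, e3, if_neg (by omega)]
          linarith
      · obtain ⟨σ, N, z, hσ, hz, hN, hyz, hle⟩ := ih τ hτ
        refine ⟨σ, N, z, hσ, hz, hN, fun i => (hy n.le_succ).trans (hyz i), ?_⟩
        have e2 : |f (y n) - f (y (n + 1))| = -(τ * (f (y (n + 1)) - f (y n))) := by
          rw [← abs_of_nonpos h, abs_mul, abs_sign_eq_one hτ, one_mul, abs_sub_comm]
        rw [Finset.sum_range_succ, e2]
        linarith
  have bound : ∀ (y : ℕ → ℝ), Antitone y → ∀ n : ℕ,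
      ∑ i ∈ Finset.range n, |f (y i) - f (y (i + 1))| ≤ T := by
    intro y hy n
    -- The final sign is chosen so that the `b` term helps. Thus `a` and `b` may be any numbers; `f`
    -- need not have them as limits.
    obtain ⟨τ, hτ, hle⟩ : ∃ τ : ℝ, (τ = 1 ∨ τ = -1) ∧ τ * (b - f (y n)) ≤ 0 := by
      rcases le_total b (f (y n)) with h | h
      · exact ⟨1, Or.inl rfl, by linarith⟩
      · exact ⟨-1, Or.inr rfl, by linarith⟩
    obtain ⟨σ, N, z, hσ, hz, hN, -, hS⟩ := claim y hy n τ hτ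
    have := H σ hσ N z hz
    rw [hN] at this
    linarith
  refine iSup_le fun p => ?_
  rw [sum_edist_eq_ofReal f p.2.1 p.1, ← sum_abs_sub_reflect]
  refine ENNReal.ofReal_le_ofReal (bound (fun i => p.2.1 (p.1 - i)) (fun i j hij => ?_) p.1)
  exact p.2.2.1 (by omega)

/-- The limits `a`, `b` are those of the initial average. The same numbers serve at time `t`, so the
behaviour of the later average at infinity never has to be studied. -/
theorem IsTransportedPotential.eVariationOn_average_le {V k : ℝ → ℝ} {C B L : ℝ} {U : ℝ → ℝ → ℝ}
    (hU : IsTransportedPotential V k C B U) (hk : IsDecreasingKernel k)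
    (hL : 0 ≤ L) (hV : ∀ a b, |V a - V b| ≤ L * |a - b|) (hanti : AntitoneOn V (Icc 0 1))
    {t : ℝ} (ht : 0 ≤ t) :
    eVariationOn (potentialAverage k (U t)) univ ≤ eVariationOn (potentialAverage k (U 0)) univ := by
  rcases eq_or_ne (eVariationOn (potentialAverage k (U 0)) univ) ⊤ with h | h
  · rw [h]; exact le_top
  obtain ⟨a, ha⟩ := BoundedVariationOn.exists_tendsto_atTop h
  obtain ⟨b, hb⟩ := BoundedVariationOn.exists_tendsto_atBot h
  rw [principal_univ, top_inf_eq] at ha hb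
  rw [← ENNReal.ofReal_toReal h]
  refine eVariationOn_le_of_sum_alternating_le (a := a) (b := b) fun σ hσ N x hx => ?_
  have := hU.alternating_sum_le hk hL hV hanti hσ N (fun z hz => by
    have := two_mul_sum_alternating_le h ha hb hσ N hz
    rwa [← le_div_iff₀' two_pos] at this) ht hx
  rwa [le_div_iff₀' two_pos] at this

/-! ### Essential variation: continuous functions and averages. -/

/-- A representative agrees with `f` on a dense set. Partition points are moved into that set, and
continuity recovers the original partition in the limit. -/
theorem eVariationOn_le_totVar_of_continuous {f : ℝ → ℝ} (hf : Continuous f) :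
    eVariationOn f univ ≤ totVar f := by
  refine le_iInf₂ fun g hg => iSup_le fun p => ?_
  obtain ⟨n, u, hu, -⟩ := p
  have hs : Dense {x | g x = f x} := Measure.dense_of_ae hg
  -- The `i`-th point is placed in the `i`-th of consecutive slots of width `1 / (m + 1)`, so that
  -- equal or close partition points stay ordered.
  have hex : ∀ (m i : ℕ), ∃ y, g y = f y ∧
      y ∈ Ioo (u i + i * (1 / ((m : ℝ) + 1))) (u i + (i + 1) * (1 / ((m : ℝ) + 1))) := by
    intro m i
    have h0 : (0 : ℝ) < 1 / ((m : ℝ) + 1) := by positivity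
    obtain ⟨y, hy, hy'⟩ := hs.exists_mem_open isOpen_Ioo
      (nonempty_Ioo.2 (show u i + i * (1 / ((m : ℝ) + 1)) < u i + (i + 1) * (1 / ((m : ℝ) + 1)) by
        linarith))
    exact ⟨y, hy, hy'⟩
  choose v hv hv' using hex
  have hmono : ∀ m, Monotone (v m) := fun m => monotone_nat_of_le_succ fun i => by
    have h1 := (hv' m i).2
    have h2 := (hv' m (i + 1)).1
    have h3 := hu i.le_succ
    push_cast at h2
    linarith
  have hlim : ∀ i, Tendsto (fun m => v m i) atTop (𝓝 (u i)) := fun i => by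
    have h0 := tendsto_one_div_add_atTop_nhds_zero_nat (𝕜 := ℝ)
    refine tendsto_of_tendsto_of_tendsto_of_le_of_le
      (g := fun m : ℕ => u i + i * (1 / ((m : ℝ) + 1)))
      (h := fun m : ℕ => u i + (i + 1) * (1 / ((m : ℝ) + 1))) ?_ ?_
      (fun m => (hv' m i).1.le) (fun m => (hv' m i).2.le)
    · simpa using (h0.const_mul (i : ℝ)).const_add (u i)
    · simpa using (h0.const_mul ((i : ℝ) + 1)).const_add (u i)
  refine le_of_tendsto (tendsto_finsetSum _ fun i _ =>
    ((hf.tendsto _).comp (hlim (i + 1))).edist ((hf.tendsto _).comp (hlim i)))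
    (Eventually.of_forall fun m => ?_)
  calc _ = ∑ i ∈ Finset.range n, edist (g (v m (i + 1))) (g (v m i)) := by
        refine Finset.sum_congr rfl fun i _ => ?_
        rw [hv, hv]; rfl
    _ ≤ _ := eVariationOn.sum_le (hmono m) fun i => mem_univ _

theorem totVar_le_eVariationOn (f : ℝ → ℝ) : totVar f ≤ eVariationOn f univ :=
  iInf₂_le_of_le f (EventuallyEq.refl _ _) le_rfl

/-- Averaging against a probability density does not increase the total variation. -/
theorem totVar_convolution_le {κ v : ℝ → ℝ} (hκ : Integrable κ) (hκ0 : ∀ x, 0 ≤ κ x)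
    (hκ1 : ∫ x, κ x = 1) (hv : MemLp v ⊤ volume) :
    totVar (fun x => ∫ y, κ (x - y) * v y) ≤ totVar v := by
  refine le_iInf₂ fun g hg => ?_
  refine (totVar_le_eVariationOn _).trans ?_
  rcases eq_or_ne (eVariationOn g univ) ⊤ with h | h
  · rw [h]; exact le_top
  have hgL : MemLp g ⊤ volume := hv.ae_eq hg.symm
  have hint : ∀ x, Integrable fun z => κ z * g (x - z) := fun x =>
    hκ.mul_bdd (c := lpNorm g ⊤ volume)
      (hgL.1.comp_quasiMeasurePreserving (quasiMeasurePreserving_sub_left volume x))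
      ((quasiMeasurePreserving_sub_left volume x).ae (ae_le_lpNorm_exponent_top hgL))
  have hconv : ∀ x, ∫ y, κ (x - y) * v y = ∫ z, κ z * g (x - z) := fun x => by
    rw [← integral_sub_left_eq_self (fun z => κ z * g (x - z)) volume x]
    refine integral_congr_ae ?_
    filter_upwards [hg] with y hy
    simp [hy]
  simp_rw [hconv]
  refine iSup_le fun p => ?_
  obtain ⟨n, u, hu, -⟩ := p
  rw [sum_edist_eq_ofReal (fun x => ∫ z, κ z * g (x - z)) u n]
  refine ENNReal.ofReal_le_of_le_toReal ?_
  have hi : ∀ i, Integrable fun z => |κ z * g (u (i + 1) - z) - κ z * g (u i - z)| := fun i =>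
    ((hint _).sub (hint _)).abs
  calc _ ≤ ∑ i ∈ Finset.range n, ∫ z, |κ z * g (u (i + 1) - z) - κ z * g (u i - z)| := by
        refine Finset.sum_le_sum fun i _ => ?_
        rw [← integral_sub (hint _) (hint _)]
        exact abs_integral_le_integral_abs
    _ = ∫ z, ∑ i ∈ Finset.range n, |κ z * g (u (i + 1) - z) - κ z * g (u i - z)| :=
        (integral_finsetSum _ fun i _ => hi i).symm
    _ ≤ ∫ z, κ z * (eVariationOn g univ).toReal := by
        refine integral_mono (integrable_finsetSum _ fun i _ => hi i) (hκ.mul_const _) fun z => ?_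
        simp only
        simp_rw [← mul_sub, abs_mul, abs_of_nonneg (hκ0 z), ← Finset.mul_sum]
        refine mul_le_mul_of_nonneg_left ?_ (hκ0 z)
        have h1 := eVariationOn.sum_le (f := g) (s := univ) (n := n) (u := fun i => u i - z)
          (fun i j hij => sub_le_sub_right (hu hij) z) fun i => mem_univ _
        rw [sum_edist_eq_ofReal g (fun i => u i - z) n] at h1
        exact (ENNReal.ofReal_le_iff_le_toReal h).1 h1
    _ = _ := by rw [integral_mul_const, hκ1, one_mul]

/-! ### Layer-cake decomposition of a convex kernel. -/

/-- The layer-cake kernel of `κ`: minus the derivative of `z ↦ κ(-z)`. -/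
noncomputable def layerKernel (κ : ℝ → ℝ) (z : ℝ) : ℝ :=
  if 0 < z then derivWithin κ (Ioi (-z)) (-z) else 0

section LayerKernel

variable {κ : ℝ → ℝ}

theorem layerKernel_of_nonpos {z : ℝ} (hz : z ≤ 0) : layerKernel κ z = 0 :=
  if_neg hz.not_gt

theorem layerKernel_of_pos {z : ℝ} (hz : 0 < z) :
    layerKernel κ z = derivWithin κ (Ioi (-z)) (-z) := if_pos hz

theorem layerKernel_nonneg (hmono : MonotoneOn κ (Iio 0)) (hconv : ConvexOn ℝ (Iio 0) κ) (z : ℝ) :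
    0 ≤ layerKernel κ z := by
  rcases le_or_gt z 0 with hz | hz
  · rw [layerKernel_of_nonpos hz]
  · rw [layerKernel_of_pos hz]
    have hm : -z ∈ interior (Iio (0 : ℝ)) := by rw [interior_Iio]; exact mem_Iio.2 (by linarith)
    have hm' : -z - 1 ∈ Iio (0 : ℝ) := mem_Iio.2 (by linarith)
    have h1 := hconv.slope_le_leftDeriv_of_mem_interior hm' hm (by linarith)
    have h2 := hconv.leftDeriv_le_rightDeriv_of_mem_interior hm
    refine le_trans ?_ (h1.trans h2)
    rw [slope_def_field]
    have := hmono hm' (interior_subset hm) (by linarith)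
    exact div_nonneg (by linarith) (by linarith)

theorem layerKernel_antitoneOn (hconv : ConvexOn ℝ (Iio 0) κ) :
    AntitoneOn (layerKernel κ) (Ioi 0) := by
  intro a ha b hb hab
  rw [layerKernel_of_pos ha, layerKernel_of_pos hb]
  rw [mem_Ioi] at ha hb
  have := hconv.monotoneOn_rightDeriv
  rw [interior_Iio] at this
  exact this (mem_Iio.2 (by linarith)) (mem_Iio.2 (by linarith)) (by linarith)

theorem layerKernel_intervalIntegrable (hconv : ConvexOn ℝ (Iio 0) κ) {a b : ℝ} (ha : 0 < a)
    (hab : a ≤ b) : IntervalIntegrable (layerKernel κ) volume a b := by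
  refine ((layerKernel_antitoneOn hconv).mono fun x hx => ?_).intervalIntegrable
  rw [uIcc_of_le hab] at hx
  exact ha.trans_le hx.1

theorem integral_layerKernel (hconv : ConvexOn ℝ (Iio 0) κ) {a b : ℝ} (ha : 0 < a) (hab : a ≤ b) :
    ∫ z in a..b, layerKernel κ z = κ (-a) - κ (-b) := by
  have h1 : ∫ z in a..b, layerKernel κ z = ∫ z in a..b, derivWithin κ (Ioi (-z)) (-z) := by
    refine intervalIntegral.integral_congr fun z hz => ?_
    rw [uIcc_of_le hab] at hz
    exact layerKernel_of_pos (ha.trans_le hz.1)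
  rw [h1, intervalIntegral.integral_comp_neg (fun x => derivWithin κ (Ioi x) x)]
  have hneg : ∀ x ∈ uIcc (-b) (-a), x ∈ interior (Iio (0 : ℝ)) := by
    intro x hx
    rw [uIcc_of_le (by linarith)] at hx
    rw [interior_Iio]
    exact mem_Iio.2 (by linarith [hx.2])
  refine intervalIntegral.integral_eq_sub_of_hasDeriv_right ?_ ?_ ?_
  · exact hconv.continuousOn_interior.mono hneg
  · intro x hx
    exact hconv.hasDerivWithinAt_rightDeriv_of_mem_interior (hneg x (Ioo_subset_Icc_self hx))
  · exact (hconv.monotoneOn_rightDeriv.mono hneg).intervalIntegrable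

/-- By monotonicity `κ ≥ κ(-z)` on `[-z, -z/2]`, so `(z / 2) κ(-z)` is at most the total mass. -/
theorem tendsto_kernel_neg_atTop (hint : Integrable κ) (h0 : ∀ x, 0 ≤ κ x)
    (hmono : MonotoneOn κ (Iio 0)) : Tendsto (fun z => κ (-z)) atTop (𝓝 0) := by
  have hbound : ∀ z > 0, κ (-z) ≤ (2 * ∫ x, κ x) / z := by
    intro z hz
    rw [le_div_iff₀ hz]
    have h1 : ∫ x in (-z)..(-(z / 2)), κ (-z) ≤ ∫ x in (-z)..(-(z / 2)), κ x := by
      refine intervalIntegral.integral_mono_on (by linarith) (by simp)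
        hint.intervalIntegrable fun x hx => ?_
      exact hmono (mem_Iio.2 (by linarith)) (mem_Iio.2 (by linarith [hx.2])) hx.1
    rw [intervalIntegral.integral_const, smul_eq_mul,
      intervalIntegral.integral_of_le (by linarith)] at h1
    have h2 : ∫ x in Ioc (-z) (-(z / 2)), κ x ≤ ∫ x, κ x :=
      setIntegral_le_integral hint (ae_of_all _ h0)
    nlinarith
  refine squeeze_zero' (Eventually.of_forall fun z => h0 _)
    ((eventually_gt_atTop 0).mono hbound) ?_
  exact tendsto_const_nhds.div_atTop tendsto_id

theorem layerKernel_integrableOn_Ioi (hint : Integrable κ) (h0 : ∀ x, 0 ≤ κ x)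
    (hmono : MonotoneOn κ (Iio 0)) (hconv : ConvexOn ℝ (Iio 0) κ) {a : ℝ} (ha : 0 < a) :
    IntegrableOn (layerKernel κ) (Ioi a) ∧ ∫ z in Ioi a, layerKernel κ z = κ (-a) := by
  have hb : Tendsto (fun n : ℕ => a + (n : ℝ)) atTop atTop :=
    tendsto_atTop_add_const_left _ _ tendsto_natCast_atTop_atTop
  have hle : ∀ n : ℕ, a ≤ a + n := fun n => by simp
  have h1 : IntegrableOn (layerKernel κ) (Ioi a) := by
    refine integrableOn_Ioi_of_intervalIntegral_norm_bounded (κ (-a)) a (fun n => ?_) hb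
      (Eventually.of_forall fun n => ?_)
    · have := layerKernel_intervalIntegrable hconv ha (hle n)
      rwa [intervalIntegrable_iff_integrableOn_Ioc_of_le (hle n)] at this
    · simp_rw [Real.norm_of_nonneg (layerKernel_nonneg hmono hconv _)]
      rw [integral_layerKernel hconv ha (hle n)]
      linarith [h0 (-(a + n))]
  refine ⟨h1, tendsto_nhds_unique (intervalIntegral_tendsto_integral_Ioi a h1 hb) ?_⟩
  simp_rw [integral_layerKernel hconv ha (hle _)]
  simpa using ((tendsto_kernel_neg_atTop hint h0 hmono).comp hb).const_sub (κ (-a))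

/-- The mass beyond `a > 0` is `κ(-a) ≤ M`; letting `a` decrease to `0` gives integrability up to
the origin. The boundedness of the kernel enters here. -/
theorem layerKernel_integrable (hint : Integrable κ) (h0 : ∀ x, 0 ≤ κ x)
    (hmono : MonotoneOn κ (Iio 0)) (hconv : ConvexOn ℝ (Iio 0) κ) {M : ℝ}
    (hM : ∀ x < 0, κ x ≤ M) : Integrable (layerKernel κ) := by
  have hpos : ∀ n : ℕ, (0 : ℝ) < 1 / ((n : ℝ) + 1) := fun n => by positivity
  have h1 : IntegrableOn (layerKernel κ) (Ioi 0) := by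
    have hres : ∀ n : ℕ, (volume.restrict (Ioi (0 : ℝ))).restrict (Ioi (1 / ((n : ℝ) + 1)))
        = volume.restrict (Ioi (1 / ((n : ℝ) + 1))) := fun n =>
      Measure.restrict_restrict_of_subset (Ioi_subset_Ioi (hpos n).le)
    refine (aecover_Ioi_of_Ioi
      tendsto_one_div_add_atTop_nhds_zero_nat).integrable_of_integral_norm_bounded M
      (fun n => ?_) (Eventually.of_forall fun n => ?_)
    · rw [IntegrableOn, hres]
      exact (layerKernel_integrableOn_Ioi hint h0 hmono hconv (hpos n)).1
    · simp_rw [Real.norm_of_nonneg (layerKernel_nonneg hmono hconv _)]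
      rw [hres, (layerKernel_integrableOn_Ioi hint h0 hmono hconv (hpos n)).2]
      exact hM _ (by linarith [hpos n])
  refine (integrableOn_iff_integrable_of_support_subset fun z hz => ?_).1 h1
  by_contra h
  exact hz (layerKernel_of_nonpos (not_lt.1 h))

/-- Convolution with `κ` of a bounded function, in terms of increments of its primitive. -/
theorem convolution_eq_layer (hint : Integrable κ) (hsupp : Function.support κ ⊆ Iic 0)
    (h0 : ∀ x, 0 ≤ κ x) (hmono : MonotoneOn κ (Iio 0)) (hconv : ConvexOn ℝ (Iio 0) κ) {M : ℝ}
    (hM : ∀ x < 0, κ x ≤ M) {v : ℝ → ℝ} (hv : Measurable v) {R : ℝ} (hR : ∀ x, |v x| ≤ R) (x : ℝ) :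
    Integrable (fun s => layerKernel κ s * ∫ z in (0 : ℝ)..s, v (x + z)) ∧
      ∫ s, layerKernel κ s * ∫ z in (0 : ℝ)..s, v (x + z) = ∫ y, κ (x - y) * v y := by
  set k := layerKernel κ with hk
  have hki : Integrable k := layerKernel_integrable hint h0 hmono hconv hM
  -- Fubini on `0 < z < s`: integrating in `s` first produces `κ (-z)`, integrating in `z` first
  -- produces the increment of the primitive.
  set G : ℝ → ℝ → ℝ := fun z s => (if 0 < z then v (x + z) else 0) * (Ioi z).indicator k s with hG
  have hGm : AEStronglyMeasurable (Function.uncurry G) (volume.prod volume) := by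
    have e : Function.uncurry G = fun p : ℝ × ℝ => (if 0 < p.1 then v (x + p.1) else 0) *
        {p : ℝ × ℝ | p.1 < p.2}.indicator (fun p => k p.2) p := by
      ext ⟨z, s⟩
      simp [hG, Function.uncurry, indicator]
    rw [e]
    refine AEStronglyMeasurable.mul ?_ ?_
    · refine (Measurable.ite (measurableSet_lt measurable_const measurable_fst) ?_
        measurable_const).aestronglyMeasurable
      exact hv.comp (measurable_const.add measurable_fst)
    · exact (hki.aestronglyMeasurable.comp_snd).indicator
        (measurableSet_lt measurable_fst measurable_snd)
  have hGs : ∀ z, ∫ s, G z s = (if 0 < z then v (x + z) else 0) * κ (-z) := by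
    intro z
    simp only [hG]
    rw [integral_const_mul, integral_indicator measurableSet_Ioi]
    split_ifs with hz
    · rw [(layerKernel_integrableOn_Ioi hint h0 hmono hconv hz).2]
    · simp
  have hGn : ∀ z, ∫ s, ‖G z s‖ = |if 0 < z then v (x + z) else 0| * κ (-z) := by
    intro z
    have : ∀ s, ‖G z s‖ = |if 0 < z then v (x + z) else 0| * (Ioi z).indicator k s := fun s => by
      simp only [hG]
      rw [Real.norm_eq_abs, abs_mul]
      congr 1
      exact abs_of_nonneg (indicator_nonneg (fun s _ => layerKernel_nonneg hmono hconv s) s)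
    simp_rw [this]
    rw [integral_const_mul, integral_indicator measurableSet_Ioi]
    split_ifs with hz
    · rw [(layerKernel_integrableOn_Ioi hint h0 hmono hconv hz).2]
    · simp
  have hGi : Integrable (Function.uncurry G) (volume.prod volume) := by
    rw [integrable_prod_iff hGm]
    refine ⟨ae_of_all _ fun z =>
      (hki.indicator measurableSet_Ioi).const_mul (if 0 < z then v (x + z) else 0), ?_⟩
    simp only [Function.uncurry]
    simp_rw [hGn]
    refine hint.comp_neg.bdd_mul (c := R) ?_ (ae_of_all _ fun z => ?_)
    · exact (Measurable.ite measurableSet_Ioi (hv.comp (measurable_const.add measurable_id))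
        measurable_const).abs.aestronglyMeasurable
    · rw [Real.norm_eq_abs, abs_abs]
      split_ifs
      · exact hR _
      · simpa using (abs_nonneg _).trans (hR 0)
  have hGz : ∀ s, ∫ z, G z s = k s * ∫ z in (0 : ℝ)..s, v (x + z) := by
    intro s
    rcases le_or_gt s 0 with hs | hs
    · have h1 : k s = 0 := layerKernel_of_nonpos hs
      have h2 : ∀ z, G z s = 0 := fun z => by
        simp only [hG, indicator]
        split_ifs <;> simp [h1]
      simp [h1, h2]
    · have h2 : ∀ z, G z s = k s * (Ioo 0 s).indicator (fun z => v (x + z)) z := fun z => by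
        by_cases h1 : 0 < z <;> by_cases h2 : z < s <;> simp [hG, indicator, h1, h2, mul_comm]
      simp_rw [h2]
      rw [integral_const_mul, integral_indicator measurableSet_Ioo,
        intervalIntegral.integral_of_le hs.le, integral_Ioc_eq_integral_Ioo]
  constructor
  · have := hGi.integral_prod_right
    simp only [Function.uncurry] at this
    simp_rw [hGz] at this
    exact this
  · have := integral_integral_swap hGi
    simp_rw [hGz, hGs] at this
    rw [← this, ← integral_add_left_eq_self (fun y => κ (x - y) * v y) x]
    refine integral_congr_ae ?_
    -- The value `κ 0` is unconstrained by the layer-cake formula, so the single point `z = 0` is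
    -- discarded.
    have hne : ∀ᵐ z : ℝ, z ≠ 0 := by simp [ae_iff]
    filter_upwards [hne] with z hz
    rw [sub_add_cancel_left]
    split_ifs with h
    · exact mul_comm _ _
    · have : κ (-z) = 0 := by
        by_contra hκ
        have h1 : -z ≤ 0 := hsupp hκ
        exact hz (le_antisymm (not_lt.1 h) (by linarith))
      rw [this]; ring

/-- The unit first moment is the convolution identity for the constant function `1`, whose primitive
has increment `z`. -/
theorem isDecreasingKernel_layerKernel (hint : Integrable κ)
    (hsupp : Function.support κ ⊆ Iic 0) (h0 : ∀ x, 0 ≤ κ x) (hmono : MonotoneOn κ (Iio 0))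
    (hconv : ConvexOn ℝ (Iio 0) κ) {M : ℝ} (hM : ∀ x < 0, κ x ≤ M) (h1 : ∫ x, κ x = 1) :
    IsDecreasingKernel (layerKernel κ) := by
  have h := convolution_eq_layer hint hsupp h0 hmono hconv hM (v := fun _ => 1) (R := 1)
    measurable_const (by simp) 0
  simp only [intervalIntegral.integral_const, sub_zero, smul_eq_mul, mul_one,
    integral_sub_left_eq_self κ volume, h1] at h
  simp_rw [mul_comm (layerKernel κ _)] at h
  exact ⟨layerKernel_nonneg hmono hconv, fun z hz => layerKernel_of_nonpos hz,
    layerKernel_antitoneOn hconv, layerKernel_integrable hint h0 hmono hconv hM, h.1, h.2⟩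

theorem convolution_eq_potentialAverage (hint : Integrable κ)
    (hsupp : Function.support κ ⊆ Iic 0) (h0 : ∀ x, 0 ≤ κ x) (hmono : MonotoneOn κ (Iio 0))
    (hconv : ConvexOn ℝ (Iio 0) κ) {M : ℝ} (hM : ∀ x < 0, κ x ≤ M) {v P : ℝ → ℝ}
    (hv : Measurable v) {R : ℝ} (hR : ∀ x, |v x| ≤ R)
    (hP : ∀ x y, P y - P x = ∫ s in x..y, v s) (x : ℝ) :
    ∫ y, κ (x - y) * v y = potentialAverage (layerKernel κ) P x := by
  rw [← (convolution_eq_layer hint hsupp h0 hmono hconv hM hv hR x).2, potentialAverage]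
  refine integral_congr_ae (ae_of_all _ fun s => ?_)
  simp only
  rw [hP, intervalIntegral.integral_comp_add_left (fun y => v y), add_zero]

end LayerKernel

/-! ### The rescaled kernel. -/

namespace IsAnisotropicKernel

variable {η : ℝ → ℝ} {ε : ℝ}

theorem integral_eq_one (hη : IsAnisotropicKernel η) : ∫ x, η x = 1 := by
  rw [← hη.mass_one, setIntegral_eq_integral_of_forall_compl_eq_zero]
  intro x hx
  by_contra h
  exact hx (hη.support_subset h)

/-- The essential bound holds at some `y` in `]x, 0[`, and monotonicity carries it to `x`. -/
theorem exists_bound (hη : IsAnisotropicKernel η) : ∃ M, ∀ x < 0, η x ≤ M := by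
  refine ⟨lpNorm η ⊤ volume, fun x hx => ?_⟩
  obtain ⟨y, hy, hxy⟩ := (Measure.dense_of_ae (ae_le_lpNorm_exponent_top hη.bounded)).exists_mem_open
    isOpen_Ioo (nonempty_Ioo.2 hx)
  exact (hη.monotone hx hxy.2 hxy.1.le).trans ((le_abs_self _).trans hy)

theorem rescaled (hη : IsAnisotropicKernel η) (hconv : ConvexOn ℝ (Iio 0) η) (hε : 0 < ε) :
    Integrable (rescaledKernel η ε) ∧ Function.support (rescaledKernel η ε) ⊆ Iic 0 ∧
      (∀ x, 0 ≤ rescaledKernel η ε x) ∧ MonotoneOn (rescaledKernel η ε) (Iio 0) ∧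
      ConvexOn ℝ (Iio 0) (rescaledKernel η ε) ∧ (∃ M, ∀ x < 0, rescaledKernel η ε x ≤ M) ∧
      ∫ x, rescaledKernel η ε x = 1 := by
  have hneg : ∀ x : ℝ, x < 0 → x / ε < 0 := fun x hx => div_neg_of_neg_of_pos hx hε
  refine ⟨(hη.integrable.comp_div hε.ne').const_mul _, fun x hx => ?_, fun x => ?_,
    fun x hx y hy hxy => ?_, ⟨convex_Iio 0, fun x hx y hy a b ha hb hab => ?_⟩, ?_, ?_⟩
  · have h1 : η (x / ε) ≠ 0 := right_ne_zero_of_mul hx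
    have h2 : x / ε ≤ 0 := hη.support_subset h1
    rw [div_le_iff₀ hε, zero_mul] at h2
    exact h2
  · exact mul_nonneg (by positivity) (hη.nonneg _)
  · exact mul_le_mul_of_nonneg_left (hη.monotone (hneg x hx) (hneg y hy) (by gcongr))
      (by positivity)
  · have h1 := hconv.2 (hneg x hx) (hneg y hy) ha hb hab
    have h2 : (a • x + b • y) / ε = a • (x / ε) + b • (y / ε) := by
      simp only [smul_eq_mul]; ring
    have h3 := mul_le_mul_of_nonneg_left h1 (show 0 ≤ 1 / ε by positivity)
    simp only [rescaledKernel, h2]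
    simp only [smul_eq_mul] at h3 ⊢
    linarith
  · obtain ⟨M, hM⟩ := hη.exists_bound
    exact ⟨1 / ε * M, fun x hx => mul_le_mul_of_nonneg_left (hM _ (hneg x hx)) (by positivity)⟩
  · simp only [rescaledKernel]
    rw [integral_const_mul, Measure.integral_comp_div, hη.integral_eq_one, abs_of_pos hε]
    simp [hε.ne']

end IsAnisotropicKernel

/-! ### Potentials of divergence-free fields in the plane. -/

/-- The mollification `∫ a(q) ρ(p - q) dq`. -/
noncomputable def mollify (ρ a : ℝ × ℝ → ℝ) (p : ℝ × ℝ) : ℝ :=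
  ∫ q, a q * ρ (p - q)

section Mollify

variable {ρ a b : ℝ × ℝ → ℝ} {A : ℝ}

theorem mollify_eq_convolution :
    mollify ρ a = convolution a ρ (ContinuousLinearMap.mul ℝ ℝ) volume := by
  ext p
  simp [mollify, convolution]

theorem locallyIntegrable_of_bound (ha : Measurable a) (hA : ∀ p, |a p| ≤ A) :
    LocallyIntegrable a := by
  refine (locallyIntegrable_const A).mono ha.aestronglyMeasurable (ae_of_all _ fun p => ?_)
  rw [Real.norm_eq_abs]
  exact (hA p).trans (le_abs_self A)

theorem contDiff_mollify (hρ : ContDiff ℝ ∞ ρ) (hc : HasCompactSupport ρ)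
    (ha : Measurable a) (hA : ∀ p, |a p| ≤ A) : ContDiff ℝ ∞ (mollify ρ a) := by
  rw [mollify_eq_convolution]
  exact hc.contDiff_convolution_right _ (locallyIntegrable_of_bound ha hA) hρ

theorem fderiv_mollify (hρ : ContDiff ℝ ∞ ρ) (hc : HasCompactSupport ρ)
    (ha : Measurable a) (hA : ∀ p, |a p| ≤ A) (p v : ℝ × ℝ) :
    fderiv ℝ (mollify ρ a) p v = ∫ q, a q * fderiv ℝ ρ (p - q) v := by
  rw [mollify_eq_convolution]
  have hla := locallyIntegrable_of_bound ha hA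
  rw [(hc.hasFDerivAt_convolution_right (ContinuousLinearMap.mul ℝ ℝ) hla
    (hρ.of_le (by exact_mod_cast le_top)) p).fderiv]
  rw [convolution_precompR_apply (ContinuousLinearMap.mul ℝ ℝ) hla (hc.fderiv ℝ)
    (hρ.continuous_fderiv (by simp))]
  simp [convolution]

theorem integrable_mul_comp_sub (hρ : Continuous ρ) (hc : HasCompactSupport ρ)
    (ha : Measurable a) (hA : ∀ p, |a p| ≤ A) (p : ℝ × ℝ) :
    Integrable fun q => a q * ρ (p - q) :=
  ((hρ.integrable_of_hasCompactSupport hc).comp_sub_left p).bdd_mul ha.aestronglyMeasurable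
    (ae_of_all _ hA)

/-- The weak identity is tested with `q ↦ ρ (p - q)`, whose derivative is minus that of `ρ` at `p -
q`. -/
theorem fderiv_mollify_add_eq_zero (hρ : ContDiff ℝ ∞ ρ) (hc : HasCompactSupport ρ)
    (ha : Measurable a) (hA : ∀ p, |a p| ≤ A) (hb : Measurable b) {B : ℝ} (hB : ∀ p, |b p| ≤ B)
    (hdiv : ∀ φ : ℝ × ℝ → ℝ, ContDiff ℝ ∞ φ → HasCompactSupport φ →
      ∫ p, (a p * fderiv ℝ φ p (1, 0) + b p * fderiv ℝ φ p (0, 1)) = 0) (p : ℝ × ℝ) :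
    fderiv ℝ (mollify ρ a) p (1, 0) + fderiv ℝ (mollify ρ b) p (0, 1) = 0 := by
  rw [fderiv_mollify hρ hc ha hA, fderiv_mollify hρ hc hb hB]
  have hfc : ∀ v : ℝ × ℝ, Continuous fun q => fderiv ℝ ρ q v := fun v =>
    (hρ.continuous_fderiv (by simp)).clm_apply continuous_const
  have hfs : ∀ v : ℝ × ℝ, HasCompactSupport fun q => fderiv ℝ ρ q v := fun v =>
    hc.fderiv_apply ℝ v
  rw [← integral_add (integrable_mul_comp_sub (hfc _) (hfs _) ha hA p)
    (integrable_mul_comp_sub (hfc _) (hfs _) hb hB p)]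
  have h := hdiv (fun q => ρ (p - q)) (hρ.comp (contDiff_const.sub contDiff_id))
    (hc.comp_homeomorph (Homeomorph.subLeft p))
  have hd : ∀ q v, fderiv ℝ (fun q => ρ (p - q)) q v = -fderiv ℝ ρ (p - q) v := by
    intro q v
    have h1 : HasFDerivAt (fun q : ℝ × ℝ => p - q) (-ContinuousLinearMap.id ℝ (ℝ × ℝ)) q :=
      (hasFDerivAt_id q).const_sub p
    have h2 := ((hρ.differentiable (by simp)) (p - q)).hasFDerivAt.comp q h1
    rw [show (fun q => ρ (p - q)) = ρ ∘ fun q => p - q from rfl, h2.fderiv]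
    simp
  simp_rw [hd] at h
  rw [← neg_eq_zero, ← integral_neg]
  refine (integral_congr_ae (ae_of_all _ fun q => ?_)).trans h
  ring

/-- Only an essential bound near `p` is required, so local estimates such as the one on `c * a - b`
along a segment survive mollification. -/
theorem abs_mollify_le (hρ : Continuous ρ) (hc : HasCompactSupport ρ) (h0 : ∀ p, 0 ≤ ρ p)
    (h1 : ∫ p, ρ p = 1) {r E : ℝ} (hr : Function.support ρ ⊆ Metric.ball 0 r) {p : ℝ × ℝ}
    (hE : ∀ᵐ q, q ∈ Metric.ball p r → |a q| ≤ E) : |mollify ρ a p| ≤ E := by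
  have hi : Integrable fun q => E * ρ (p - q) := ((hρ.integrable_of_hasCompactSupport hc).comp_sub_left p).const_mul E
  have := norm_integral_le_of_norm_le hi (f := fun q => a q * ρ (p - q)) (by
    filter_upwards [hE] with q hq
    rw [norm_mul, Real.norm_eq_abs, Real.norm_eq_abs, abs_of_nonneg (h0 _)]
    by_cases hqp : ρ (p - q) = 0
    · simp [hqp]
    · refine mul_le_mul_of_nonneg_right (hq ?_) (h0 _)
      have := hr hqp
      rw [mem_ball_zero_iff] at this
      rwa [Metric.mem_ball, dist_comm, dist_eq_norm])
  rw [integral_const_mul, integral_sub_left_eq_self ρ volume p, h1, mul_one] at this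
  exact this

end Mollify

/-- A planar `C¹` field `(a, b)` with `∂ₜ a + ∂ₓ b = 0` has a potential. -/
theorem exists_smooth_potential {a b : ℝ × ℝ → ℝ} (ha : ContDiff ℝ ∞ a) (hb : ContDiff ℝ ∞ b)
    (hdiv : ∀ p, fderiv ℝ a p (1, 0) + fderiv ℝ b p (0, 1) = 0) :
    ∃ U : ℝ → ℝ → ℝ, U 0 0 = 0 ∧
      (∀ t x y, U t y - U t x = ∫ s in x..y, a (t, s)) ∧
      (∀ t t' x, U t' x - U t x = -∫ s in t..t', b (s, x)) ∧
      ∀ t h x c, U (t + h) x - U t (x - h * c)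
        = ∫ s in (0 : ℝ)..h, (c * a (t + s, x - (h - s) * c) - b (t + s, x - (h - s) * c)) := by
  have hac := ha.continuous
  have hbc := hb.continuous
  have hai : ∀ t x y, IntervalIntegrable (fun s => a (t, s)) volume x y := fun t x y =>
    (hac.comp (by fun_prop)).intervalIntegrable x y
  have hbi : ∀ x t t', IntervalIntegrable (fun s => b (s, x)) volume t t' := fun x t t' =>
    (hbc.comp (by fun_prop)).intervalIntegrable t t'
  -- The divergence theorem on the rectangle with corners `(0, 0)` and `(t, x)`; it makes the two
  -- path integrals defining `U` agree.
  have rect : ∀ t x, ∫ s in (0 : ℝ)..x, a (t, s) = (∫ s in (0 : ℝ)..x, a (0, s))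
      - (∫ s in (0 : ℝ)..t, b (s, x)) + ∫ s in (0 : ℝ)..t, b (s, 0) := by
    intro t x
    have h := integral2_divergence_prod_of_hasFDerivAt_off_countable a b (fderiv ℝ a) (fderiv ℝ b)
      0 0 t x ∅ countable_empty hac.continuousOn hbc.continuousOn
      (fun p _ => (ha.differentiable (by simp) p).hasFDerivAt)
      (fun p _ => (hb.differentiable (by simp) p).hasFDerivAt) (by simp [hdiv])
    simp only [hdiv, intervalIntegral.integral_zero] at h
    linarith
  set U : ℝ → ℝ → ℝ := fun t x => (∫ s in (0 : ℝ)..x, a (t, s)) - ∫ s in (0 : ℝ)..t, b (s, 0) with hU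
  have hU' : ∀ t x, U t x = (∫ s in (0 : ℝ)..x, a (0, s)) - ∫ s in (0 : ℝ)..t, b (s, x) :=
    fun t x => by simp only [hU]; rw [rect]; ring
  have hx : ∀ t x y, U t y - U t x = ∫ s in x..y, a (t, s) := fun t x y => by
    rw [← intervalIntegral.integral_interval_sub_left (hai t 0 y) (hai t 0 x)]
    simp only [hU]; ring
  have ht : ∀ t t' x, U t' x - U t x = -∫ s in t..t', b (s, x) := fun t t' x => by
    rw [hU', hU', ← intervalIntegral.integral_interval_sub_left (hbi x 0 t') (hbi x 0 t)]
    ring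
  have hdt : ∀ p : ℝ × ℝ, HasFDerivAt (fun t => U t p.2)
      (ContinuousLinearMap.toSpanSingleton ℝ (-b p)) p.1 := fun p => by
    have e : (fun t => U t p.2) = fun t =>
        (∫ s in (0 : ℝ)..p.2, a (0, s)) - ∫ s in (0 : ℝ)..t, b (s, p.2) := funext fun t => hU' t p.2
    rw [e]
    have hcont : Continuous fun s => b (s, p.2) := hbc.comp (by fun_prop)
    exact ((hcont.integral_hasStrictDerivAt 0 p.1).hasDerivAt.const_sub _).hasFDerivAt
  have hdx : ∀ p : ℝ × ℝ, HasFDerivAt (fun x => U p.1 x)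
      (ContinuousLinearMap.toSpanSingleton ℝ (a p)) p.2 := fun p => by
    have hcont : Continuous fun s => a (p.1, s) := hac.comp (by fun_prop)
    exact ((hcont.integral_hasStrictDerivAt 0 p.2).hasDerivAt.sub_const _).hasFDerivAt
  have hspan : Continuous fun z : ℝ => ContinuousLinearMap.toSpanSingleton ℝ z :=
    (ContinuousLinearMap.toSpanSingletonCLE (𝕜 := ℝ) (E := ℝ)).continuous
  refine ⟨U, by simp [hU], hx, ht, fun t h x c => ?_⟩
  -- Along the line of slope `c` ending at `(t + h, x)` the derivative of `U` is `∂ₜU + c ∂ₓU = c a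
  -- - b`.
  have hd : ∀ s, HasDerivAt (fun s => U (t + s) (x - (h - s) * c))
      (c * a (t + s, x - (h - s) * c) - b (t + s, x - (h - s) * c)) s := by
    intro s
    have h1 := (hasStrictFDerivAt_uncurry_coprod (u := (t + s, x - (h - s) * c)) (f := U)
      (f₁ := fun t x => ContinuousLinearMap.toSpanSingleton ℝ (-b (t, x)))
      (f₂ := fun t x => ContinuousLinearMap.toSpanSingleton ℝ (a (t, x)))
      (Eventually.of_forall hdt) (Eventually.of_forall hdx)
      (hspan.comp hbc.neg).continuousAt (hspan.comp hac).continuousAt).hasFDerivAt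
    have h2 : HasDerivAt (fun s : ℝ => (t + s, x - (h - s) * c)) (1, c) s := by
      refine ((hasDerivAt_id s).const_add t).prodMk ?_
      have := (((hasDerivAt_id s).const_sub h).mul_const c).const_sub x
      simpa using this
    have h3 := h1.comp_hasDerivAt s h2
    refine h3.congr_deriv ?_
    rw [ContinuousLinearMap.coprod_apply]
    change (1 : ℝ) • (-b (t + s, x - (h - s) * c)) + c • a (t + s, x - (h - s) * c) = _
    simp only [smul_eq_mul]
    ring
  have := intervalIntegral.integral_eq_sub_of_hasDerivAt (a := 0) (b := h) (fun s _ => hd s)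
    (by
      apply Continuous.intervalIntegrable
      have h1 : Continuous fun s => a (t + s, x - (h - s) * c) := hac.comp (by fun_prop)
      have h2 : Continuous fun s => b (t + s, x - (h - s) * c) := hbc.comp (by fun_prop)
      fun_prop)
  rw [this]
  simp

/-- A bounded planar field `(a, b)` that is divergence free in the sense of distributions has a
Lipschitz potential. -/
theorem exists_potential {a b : ℝ × ℝ → ℝ} {A B : ℝ} (ha : Measurable a) (hA : ∀ p, |a p| ≤ A)
    (hb : Measurable b) (hB : ∀ p, |b p| ≤ B)
    (hdiv : ∀ φ : ℝ × ℝ → ℝ, ContDiff ℝ ∞ φ → HasCompactSupport φ →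
      ∫ p, (a p * fderiv ℝ φ p (1, 0) + b p * fderiv ℝ φ p (0, 1)) = 0) :
    ∃ U : ℝ → ℝ → ℝ,
      (∀ t x y, |U t x - U t y| ≤ A * |x - y|) ∧
      (∀ t t' x, |U t x - U t' x| ≤ B * |t - t'|) ∧
      (∀ᵐ t, ∀ x y, U t y - U t x = ∫ s in x..y, a (t, s)) ∧
      ∀ t h x c E r, 0 ≤ h → 0 < r →
        (∀ s ∈ Icc 0 h, ∀ᵐ p, p ∈ Metric.ball (t + s, x - (h - s) * c) r →
          |c * a p - b p| ≤ E) → |U (t + h) x - U t (x - h * c)| ≤ E * h := by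
  set φ : ℕ → ContDiffBump (0 : ℝ × ℝ) := fun n =>
    ⟨1 / ((n : ℝ) + 1) / 2, 1 / ((n : ℝ) + 1), by positivity, half_lt_self (by positivity)⟩ with hφ
  have hrout : Tendsto (fun n => (φ n).rOut) atTop (𝓝 0) :=
    tendsto_one_div_add_atTop_nhds_zero_nat
  set ρ : ℕ → ℝ × ℝ → ℝ := fun n => (φ n).normed volume with hρ
  have hρs : ∀ n, ContDiff ℝ ∞ (ρ n) := fun n => (φ n).contDiff_normed
  have hρc : ∀ n, HasCompactSupport (ρ n) := fun n => (φ n).hasCompactSupport_normed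
  have hρ0 : ∀ n p, 0 ≤ ρ n p := fun n p => (φ n).nonneg_normed p
  have hρ1 : ∀ n, ∫ p, ρ n p = 1 := fun n => (φ n).integral_normed
  have hρr : ∀ n, Function.support (ρ n) ⊆ Metric.ball 0 (φ n).rOut := fun n =>
    ((φ n).support_normed_eq).subset
  have hma := fun n => contDiff_mollify (hρs n) (hρc n) ha hA
  have hmb := fun n => contDiff_mollify (hρs n) (hρc n) hb hB
  have hmA : ∀ n p, |mollify (ρ n) a p| ≤ A := fun n p =>
    abs_mollify_le (hρs n).continuous (hρc n) (hρ0 n) (hρ1 n) (hρr n)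
      (ae_of_all _ fun q _ => hA q)
  have hmB : ∀ n p, |mollify (ρ n) b p| ≤ B := fun n p =>
    abs_mollify_le (hρs n).continuous (hρc n) (hρ0 n) (hρ1 n) (hρr n)
      (ae_of_all _ fun q _ => hB q)
  choose u hu0 hux hut hus using fun n => exists_smooth_potential (hma n) (hmb n)
    (fderiv_mollify_add_eq_zero (hρs n) (hρc n) ha hA hb hB hdiv)
  have hlx : ∀ n t x y, |u n t x - u n t y| ≤ A * |x - y| := fun n t x y => by
    rw [hux, ← Real.norm_eq_abs]
    exact intervalIntegral.norm_integral_le_of_norm_le_const fun s _ => hmA n _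
  have hlt : ∀ n t t' x, |u n t x - u n t' x| ≤ B * |t - t'| := fun n t t' x => by
    rw [hut, abs_neg, ← Real.norm_eq_abs]
    exact intervalIntegral.norm_integral_le_of_norm_le_const fun s _ => hmB n _
  have hbd : ∀ t x n, u n t x ∈ Icc (-(A * |x| + B * |t|)) (A * |x| + B * |t|) := fun t x n => by
    rw [mem_Icc, ← abs_le]
    have h1 := hlx n t x 0
    have h2 := hlt n t 0 0
    rw [sub_zero] at h1 h2
    rw [hu0, sub_zero] at h2
    have h3 := abs_sub_abs_le_abs_sub (u n t x) (u n t 0)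
    linarith
  -- Limits along a fixed ultrafilter exist at every point by boundedness alone, so no subsequence
  -- has to be extracted.
  have hlim : ∀ t x, ∃ l, Tendsto (fun n => u n t x) (hyperfilter ℕ : Filter ℕ) (𝓝 l) := by
    intro t x
    obtain ⟨l, -, hl⟩ := isCompact_Icc.ultrafilter_le_nhds
      ((hyperfilter ℕ).map fun n => u n t x)
      (by rw [le_principal_iff]; exact Filter.mem_map.2 (univ_mem' (hbd t x)))
    exact ⟨l, hl⟩
  choose U hU using hlim
  refine ⟨U, fun t x y => ?_, fun t t' x => ?_, ?_, ?_⟩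
  · exact le_of_tendsto ((hU t x).sub (hU t y)).abs (Eventually.of_forall fun n => hlx n t x y)
  · exact le_of_tendsto ((hU t x).sub (hU t' x)).abs (Eventually.of_forall fun n => hlt n t t' x)
  · have h1 := ContDiffBump.ae_convolution_tendsto_right_of_locallyIntegrable (μ := volume)
      (φ := φ) (K := 2) hrout (Eventually.of_forall fun n => by simp only [hφ]; linarith)
      (locallyIntegrable_of_bound ha hA)
    have h2 : ∀ᵐ p : ℝ × ℝ, Tendsto (fun n => mollify (ρ n) a p) atTop (𝓝 (a p)) := by
      filter_upwards [h1] with p hp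
      refine hp.congr fun n => ?_
      rw [mollify, convolution, ← integral_sub_left_eq_self _ volume p]
      simp [hρ, mul_comm]
    have h3 : ∀ᵐ t : ℝ, ∀ᵐ x : ℝ,
        Tendsto (fun n => mollify (ρ n) a (t, x)) atTop (𝓝 (a (t, x))) :=
      Measure.ae_ae_of_ae_prod h2
    filter_upwards [h3] with t ht x y
    refine tendsto_nhds_unique ((hU t y).sub (hU t x)) ?_
    simp_rw [hux]
    refine Tendsto.mono_left ?_ Nat.hyperfilter_le_atTop
    refine intervalIntegral.tendsto_integral_filter_of_dominated_convergence (fun _ => A)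
      (Eventually.of_forall fun n => ?_) (Eventually.of_forall fun n => ?_) (by simp) ?_
    · exact ((hma n).continuous.comp (by fun_prop)).aestronglyMeasurable
    · exact ae_of_all _ fun s _ => hmA n _
    · filter_upwards [ht] with s hs _ using hs
  · intro t h x c E r hh hr hE
    refine le_of_tendsto ((hU (t + h) x).sub (hU t (x - h * c))).abs ?_
    have hev : ∀ᶠ n in (hyperfilter ℕ : Filter ℕ), (φ n).rOut < r :=
      Nat.hyperfilter_le_atTop (hrout.eventually (gt_mem_nhds hr))
    filter_upwards [hev] with n hn
    rw [hus]
    have key : ∀ s ∈ Icc 0 h, |c * mollify (ρ n) a (t + s, x - (h - s) * c)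
        - mollify (ρ n) b (t + s, x - (h - s) * c)| ≤ E := by
      intro s hs
      set p : ℝ × ℝ := (t + s, x - (h - s) * c)
      have e : c * mollify (ρ n) a p - mollify (ρ n) b p
          = mollify (ρ n) (fun q => c * a q - b q) p := by
        rw [mollify, mollify, mollify, ← integral_const_mul, ← integral_sub
          ((integrable_mul_comp_sub (hρs n).continuous (hρc n) ha hA p).const_mul c)
          (integrable_mul_comp_sub (hρs n).continuous (hρc n) hb hB p)]
        refine integral_congr_ae (ae_of_all _ fun q => ?_)
        simp only
        ring
      rw [e]
      refine abs_mollify_le (hρs n).continuous (hρc n) (hρ0 n) (hρ1 n) (hρr n) ?_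
      filter_upwards [hE s hs] with q hq hqb
      exact hq (Metric.ball_subset_ball hn.le hqb)
    have := intervalIntegral.norm_integral_le_of_norm_le_const (a := 0) (b := h) (C := E)
      (f := fun s => c * mollify (ρ n) a (t + s, x - (h - s) * c)
        - mollify (ρ n) b (t + s, x - (h - s) * c)) (fun s hs => by
        rw [uIoc_of_le hh] at hs
        exact key s ⟨hs.1.le, hs.2⟩)
    rwa [sub_zero, abs_of_nonneg hh] at this

/-! ### From the distributional solution to a divergence-free field. -/

/-- An essentially bounded function has a measurable version with values in the same interval. -/
theorem exists_measurable_version {α : Type*} [MeasurableSpace α] {μ : Measure α} {f : α → ℝ}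
    {m M : ℝ} (hf : AEStronglyMeasurable f μ) (hmM : m ≤ M) (h : ∀ᵐ x ∂μ, m ≤ f x ∧ f x ≤ M) :
    ∃ g : α → ℝ, Measurable g ∧ (∀ x, m ≤ g x ∧ g x ≤ M) ∧ f =ᵐ[μ] g := by
  refine ⟨fun x => max m (min M (hf.mk f x)), ?_, fun x =>
    ⟨le_max_left _ _, max_le hmM (min_le_left _ _)⟩, ?_⟩
  · exact measurable_const.max (measurable_const.min hf.stronglyMeasurable_mk.measurable)
  · filter_upwards [hf.ae_eq_mk, h] with x hx hx'
    rw [← hx, min_eq_right hx'.2, max_eq_right hx'.1]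

theorem restrict_halfPlane :
    (volume : Measure (ℝ × ℝ)).restrict halfPlane
      = ((volume : Measure ℝ).restrict (Ici 0)).prod volume := by
  rw [halfPlane, Measure.volume_eq_prod, ← Measure.prod_restrict, Measure.restrict_univ]

theorem measurableSet_halfPlane : MeasurableSet halfPlane :=
  measurableSet_Ici.prod MeasurableSet.univ

theorem ae_halfPlane_of_ae_time {Q : ℝ → Prop} (h : ∀ᵐ t ∂(volume.restrict (Ici (0 : ℝ))), Q t) :
    ∀ᵐ p ∂((volume : Measure (ℝ × ℝ)).restrict halfPlane), Q p.1 := by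
  rw [restrict_halfPlane]
  exact Measure.quasiMeasurePreserving_fst.ae h

theorem ae_pos_time : ∀ᵐ t ∂(volume.restrict (Ici (0 : ℝ))), 0 < t := by
  rw [← restrict_Ioi_eq_restrict_Ici]
  exact ae_restrict_mem measurableSet_Ioi

/-- Integration by parts on `t < 0` for data that do not depend on time. -/
theorem integral_compl_halfPlane {v : ℝ → ℝ} (hv : Measurable v) {R : ℝ} (hR : ∀ x, |v x| ≤ R)
    {φ : ℝ × ℝ → ℝ} (hφ : ContDiff ℝ ∞ φ) (hc : HasCompactSupport φ) :
    ∫ p in halfPlaneᶜ, v p.2 * fderiv ℝ φ p (1, 0) = ∫ x, v x * φ (0, x) := by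
  have hcompl : halfPlaneᶜ = Iio (0 : ℝ) ×ˢ (univ : Set ℝ) := by
    ext p; simp [halfPlane]
  have hint : Integrable (fun p : ℝ × ℝ => v p.2 * fderiv ℝ φ p (1, 0)) := by
    refine Integrable.bdd_mul (c := R) ?_ (hv.comp measurable_snd).aestronglyMeasurable
      (ae_of_all _ fun p => hR _)
    exact ((hφ.continuous_fderiv (by simp)).clm_apply continuous_const).integrable_of_hasCompactSupport
      (hc.fderiv_apply ℝ _)
  have e : (volume : Measure (ℝ × ℝ)).restrict halfPlaneᶜ
      = ((volume : Measure ℝ).restrict (Iio 0)).prod volume := by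
    rw [hcompl, Measure.volume_eq_prod, ← Measure.prod_restrict, Measure.restrict_univ]
  have hint' := hint.restrict (s := halfPlaneᶜ)
  rw [e] at hint' ⊢
  rw [integral_prod_symm _ hint']
  refine integral_congr_ae (ae_of_all _ fun x => ?_)
  simp only
  rw [integral_const_mul, ← integral_Iic_eq_integral_Iio]
  congr 1
  have hd : ∀ t, HasDerivAt (fun t => φ (t, x)) (fderiv ℝ φ (t, x) (1, 0)) t := fun t => by
    have h1 : HasDerivAt (fun t : ℝ => (t, x)) (1, 0) t :=
      (hasDerivAt_id t).prodMk (hasDerivAt_const t x)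
    exact ((hφ.differentiable (by simp)) (t, x)).hasFDerivAt.comp_hasDerivAt t h1
  have h1 : ContDiff ℝ 1 fun t => φ (t, x) :=
    (hφ.of_le (by exact_mod_cast le_top)).comp (contDiff_id.prodMk contDiff_const)
  have h2 : HasCompactSupport fun t => φ (t, x) := by
    refine HasCompactSupport.of_support_subset_isCompact (hc.isCompact.image continuous_fst) ?_
    intro t ht
    exact ⟨(t, x), subset_tsupport _ ht, rfl⟩
  rw [← h2.integral_Iic_deriv_eq h1 0]
  exact integral_congr_ae (ae_of_all _ fun t => (hd t).deriv.symm)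

theorem nonlocalTerm_congr_ae {η : ℝ → ℝ} {ε : ℝ} {v v' : ℝ → ℝ} (h : v =ᵐ[volume] v') (x : ℝ) :
    nonlocalTerm η ε v x = nonlocalTerm η ε v' x := by
  refine integral_congr_ae ?_
  filter_upwards [h] with y hy
  rw [hy]

theorem measurable_nonlocalTerm {η : ℝ → ℝ} {ε : ℝ} (hκ : Integrable (rescaledKernel η ε))
    {v : ℝ × ℝ → ℝ} (hv : Measurable v) :
    Measurable fun p : ℝ × ℝ => nonlocalTerm η ε (fun y => v (p.1, y)) p.2 := by
  obtain ⟨κ', hκ', hκe⟩ := hκ.aestronglyMeasurable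
  have e : (fun p : ℝ × ℝ => nonlocalTerm η ε (fun y => v (p.1, y)) p.2)
      = fun p : ℝ × ℝ => ∫ y, κ' (p.2 - y) * v (p.1, y) := by
    ext p
    refine integral_congr_ae ?_
    filter_upwards [(quasiMeasurePreserving_sub_left volume p.2).ae hκe] with y hy
    rw [hy]
  rw [e]
  refine (StronglyMeasurable.integral_prod_right
    (f := fun (p : ℝ × ℝ) y => κ' (p.2 - y) * v (p.1, y)) ?_).measurable
  refine Measurable.stronglyMeasurable ?_
  have := hκ'.measurable
  fun_prop

theorem abs_nonlocalTerm_le {η : ℝ → ℝ} {ε : ℝ} (hκ : Integrable (rescaledKernel η ε))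
    (h0 : ∀ x, 0 ≤ rescaledKernel η ε x) (h1 : ∫ x, rescaledKernel η ε x = 1) {v : ℝ → ℝ} {R : ℝ}
    (hR : ∀ x, |v x| ≤ R) (x : ℝ) : |nonlocalTerm η ε v x| ≤ R := by
  have := norm_integral_le_of_norm_le ((hκ.comp_sub_left x).mul_const R)
    (f := fun y => rescaledKernel η ε (x - y) * v y) (ae_of_all _ fun y => by
      rw [norm_mul, Real.norm_eq_abs, Real.norm_eq_abs, abs_of_nonneg (h0 _)]
      exact mul_le_mul_of_nonneg_left (hR y) (h0 _))
  rw [integral_mul_const, integral_sub_left_eq_self (rescaledKernel η ε) volume x, h1,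
    one_mul] at this
  exact this

/-- Extended by the initial datum and by a vanishing flux to negative times, a distributional
solution becomes a bounded divergence free field on the plane. -/
theorem IsDistributionalSolution.exists_field {V η : ℝ → ℝ} {ε : ℝ} {u₀ : ℝ → ℝ} {u : ℝ → ℝ → ℝ}
    (hu : IsDistributionalSolution V η ε u₀ u) (hu₀ : AEStronglyMeasurable u₀ volume)
    (hu₀_range : ∀ᵐ x, 0 ≤ u₀ x ∧ u₀ x ≤ 1) {L : ℝ} (hL : 0 ≤ L)
    (hV : ∀ a b, |V a - V b| ≤ L * |a - b|)
    (hκ : Integrable (rescaledKernel η ε)) (h0 : ∀ x, 0 ≤ rescaledKernel η ε x)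
    (h1 : ∫ x, rescaledKernel η ε x = 1) :
    ∃ (a b : ℝ × ℝ → ℝ) (v₀ : ℝ → ℝ) (A B : ℝ), Measurable a ∧ (∀ p, |a p| ≤ A) ∧
      Measurable b ∧ (∀ p, |b p| ≤ B) ∧ Measurable v₀ ∧ (∀ x, 0 ≤ v₀ x ∧ v₀ x ≤ 1) ∧
      u₀ =ᵐ[volume] v₀ ∧ (∀ t ≤ 0, ∀ x, a (t, x) = v₀ x) ∧
      (∀ᵐ t ∂(volume.restrict (Ioi (0 : ℝ))), u t =ᵐ[volume] fun x => a (t, x)) ∧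
      (∀ p, 0 < p.1 → b p = a p * V (nonlocalTerm η ε (fun y => a (p.1, y)) p.2)) ∧
      ∀ φ : ℝ × ℝ → ℝ, ContDiff ℝ ∞ φ → HasCompactSupport φ →
        ∫ p, (a p * fderiv ℝ φ p (1, 0) + b p * fderiv ℝ φ p (0, 1)) = 0 := by
  obtain ⟨v₀, hv₀m, hv₀, hv₀e⟩ := exists_measurable_version hu₀ zero_le_one hu₀_range
  set N := lpNorm (fun p : ℝ × ℝ => u p.1 p.2) ⊤ (volume.restrict halfPlane) with hN
  have hN0 : 0 ≤ N := lpNorm_nonneg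
  obtain ⟨u', hu'm, hu', hu'e⟩ := exists_measurable_version (m := -N) (M := N) hu.bounded.1
    (by linarith) ((ae_le_lpNorm_exponent_top hu.bounded).mono fun p hp => abs_le.1 hp)
  set A := max 1 N with hA
  have hA1 : 1 ≤ A := le_max_left _ _
  have hNA : N ≤ A := le_max_right _ _
  set a : ℝ × ℝ → ℝ := fun p => if 0 < p.1 then u' p else v₀ p.2 with ha
  have hpos : MeasurableSet {p : ℝ × ℝ | 0 < p.1} := measurableSet_lt measurable_const measurable_fst
  have ham : Measurable a := Measurable.ite hpos hu'm (hv₀m.comp measurable_snd)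
  have haA : ∀ p, |a p| ≤ A := fun p => by
    simp only [ha]
    split_ifs
    · exact (abs_le.2 (hu' p)).trans hNA
    · rw [abs_of_nonneg (hv₀ _).1]
      exact (hv₀ _).2.trans hA1
  set w : ℝ × ℝ → ℝ := fun p => nonlocalTerm η ε (fun y => a (p.1, y)) p.2 with hw
  have hwm : Measurable w := measurable_nonlocalTerm hκ ham
  have hwA : ∀ p, |w p| ≤ A := fun p => abs_nonlocalTerm_le hκ h0 h1 (fun y => haA _) _
  set b : ℝ × ℝ → ℝ := fun p => if 0 < p.1 then a p * V (w p) else 0 with hb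
  have hVc : Continuous V := continuous_of_abs_sub_le hV
  have hbm : Measurable b :=
    Measurable.ite hpos (ham.mul (hVc.measurable.comp hwm)) measurable_const
  have hbB : ∀ p, |b p| ≤ A * (|V 0| + L * A) := fun p => by
    simp only [hb]
    split_ifs
    · rw [abs_mul]
      have h2 := hV (w p) 0
      rw [sub_zero] at h2
      have h3 := mul_le_mul_of_nonneg_left (hwA p) hL
      have h4 := abs_sub_abs_le_abs_sub (V (w p)) (V 0)
      exact mul_le_mul (haA p) (by linarith) (abs_nonneg _) (by linarith)
    · rw [abs_zero]; positivity
  have hslice : ∀ᵐ t ∂(volume.restrict (Ici (0 : ℝ))), u t =ᵐ[volume] fun x => a (t, x) := by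
    have h2 := hu'e
    rw [restrict_halfPlane] at h2
    filter_upwards [Measure.ae_ae_of_ae_prod h2, ae_pos_time] with t ht ht0
    filter_upwards [ht] with x hx
    simp only [ha, if_pos ht0]
    exact hx
  refine ⟨a, b, v₀, A, A * (|V 0| + L * A), ham, haA, hbm, hbB, hv₀m, hv₀, hv₀e, ?_, ?_, ?_, ?_⟩
  · intro t ht x
    simp only [ha]
    rw [if_neg (not_lt.2 ht)]
  · rwa [restrict_Ioi_eq_restrict_Ici]
  · intro p hp
    simp only [hb, if_pos hp, hw]
  intro φ hφ hc
  have hfi : ∀ e : ℝ × ℝ, Integrable fun p => fderiv ℝ φ p e := fun e =>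
    ((hφ.continuous_fderiv (by simp)).clm_apply continuous_const).integrable_of_hasCompactSupport
      (hc.fderiv_apply ℝ _)
  have hint : Integrable fun p => a p * fderiv ℝ φ p (1, 0) + b p * fderiv ℝ φ p (0, 1) :=
    ((hfi _).bdd_mul ham.aestronglyMeasurable (ae_of_all _ haA)).add
      ((hfi _).bdd_mul hbm.aestronglyMeasurable (ae_of_all _ hbB))
  rw [← integral_add_compl measurableSet_halfPlane hint]
  refine Eq.trans ?_ (hu.weak_form φ hφ hc)
  congr 1
  · refine integral_congr_ae ?_
    filter_upwards [ae_halfPlane_of_ae_time hslice, ae_halfPlane_of_ae_time ae_pos_time, hu'e]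
      with p hp hp0 hpe
    have h2 : a p = u p.1 p.2 := by
      simp only [ha, if_pos hp0]
      exact hpe.symm
    simp only [hb, if_pos hp0, hw]
    rw [nonlocalTerm_congr_ae hp, h2]
    ring
  · have h2 : ∫ x, u₀ x * φ (0, x) = ∫ x, v₀ x * φ (0, x) := by
      refine integral_congr_ae ?_
      filter_upwards [hv₀e] with x hx
      rw [hx]
    -- The initial term of the weak formulation is exactly the contribution of the extension to `t <
    -- 0`.
    rw [h2, ← integral_compl_halfPlane (R := 1) hv₀m
      (fun x => by rw [abs_of_nonneg (hv₀ x).1]; exact (hv₀ x).2) hφ hc]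
    refine setIntegral_congr_fun measurableSet_halfPlane.compl fun p hp => ?_
    have hp0 : ¬ 0 < p.1 := fun h => hp ⟨h.le, mem_univ _⟩
    simp only [hb, ha, if_neg hp0]
    ring

/-! ### Consistency of the Euler step and conclusion. -/

/-- The potential of a bounded divergence free field with flux `a V(w)` for `t > 0` satisfies the
consistency estimate of the backward Euler scheme. -/
theorem isTransportedPotential_of_field {V k : ℝ → ℝ} {A B L : ℝ} {a b : ℝ × ℝ → ℝ}
    {U : ℝ → ℝ → ℝ} (hk : IsDecreasingKernel k) (hL : 0 ≤ L)
    (hV : ∀ x y, |V x - V y| ≤ L * |x - y|) (hA : ∀ p, |a p| ≤ A) (hB0 : 0 ≤ B)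
    (hUx : ∀ t x y, |U t x - U t y| ≤ A * |x - y|)
    (hUt : ∀ t t' x, |U t x - U t' x| ≤ B * |t - t'|)
    (hUs : ∀ t h x c E r, 0 ≤ h → 0 < r →
      (∀ s ∈ Icc 0 h, ∀ᵐ p, p ∈ Metric.ball (t + s, x - (h - s) * c) r →
        |c * a p - b p| ≤ E) → |U (t + h) x - U t (x - h * c)| ≤ E * h)
    (hb : ∀ᵐ p : ℝ × ℝ, 0 < p.1 → b p = a p * V (potentialAverage k (U p.1) p.2))
    (hmono : Monotone (U 0)) (hlip : ∀ x y, |U 0 x - U 0 y| ≤ 1 * |x - y|) :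
    ∃ C, IsTransportedPotential V k A C U := by
  have hA0 : 0 ≤ A := (abs_nonneg _).trans (hA 0)
  set K := ∫ z, k z with hK
  have hK0 : 0 ≤ K := hk.integral_nonneg
  set F := |V 0| + L * A with hF
  have hF0 : 0 ≤ F := by positivity
  have hVF : ∀ t x, |V (potentialAverage k (U t) x)| ≤ F := fun t x => by
    have h1 := hV (potentialAverage k (U t) x) 0
    rw [sub_zero] at h1
    have h2 := mul_le_mul_of_nonneg_left (hk.abs_average_le (hUx t) x) hL
    have h3 := abs_sub_abs_le_abs_sub (V (potentialAverage k (U t) x)) (V 0)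
    linarith
  refine ⟨2 * B + A * L * (2 * K * (3 * B + A * (F + 1))), fun t _ => hUx t,
    fun t h ht hh hh1 x => ?_, hmono, hlip⟩
  set c := V (potentialAverage k (U (t + h)) x) with hc
  have hh2 : h ^ 2 ≤ h := by nlinarith
  have hhpos : 0 < h ^ 2 := by positivity
  -- The flux formula is known only for positive times. Starting at `t + h ^ 2` keeps the balls of
  -- radius `h ^ 2` in `t > 0` even when `t = 0`, and costs `2 * B * h ^ 2` through the time
  -- Lipschitz bound.
  have h1 := hUs (t + h ^ 2) h x c (A * L * (2 * K * (3 * B + A * (F + 1))) * h) (h ^ 2) hh.le hhpos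
    (fun s hs => by
      filter_upwards [hb] with p hp hpb
      rw [Metric.mem_ball, Prod.dist_eq, max_lt_iff, Real.dist_eq, Real.dist_eq, abs_lt, abs_lt] at hpb
      obtain ⟨⟨p1, p2⟩, p3, p4⟩ := hpb
      simp only at p1 p2 p3 p4
      rw [hp (by linarith [hs.1]), mul_comm c, ← mul_sub, abs_mul]
      have hcF := abs_le.1 (hVF (t + h) x)
      rw [← hc] at hcF
      have hsc : |(h - s) * c| ≤ h * F := by
        rw [abs_mul]
        refine mul_le_mul ?_ (hVF _ _) (abs_nonneg _) hh.le
        rw [abs_of_nonneg (by linarith [hs.2])]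
        linarith [hs.1]
      have e1 : |t + h - p.1| ≤ 3 * h := by
        rw [abs_le]; constructor <;> linarith [hs.1, hs.2]
      have e2 : |x - p.2| ≤ (F + 1) * h := by
        rw [abs_le] at hsc ⊢
        constructor <;> linarith [hsc.1, hsc.2]
      have e3 : |potentialAverage k (U (t + h)) x - potentialAverage k (U p.1) p.2|
          ≤ 2 * (B * (3 * h) + A * ((F + 1) * h)) * K := by
        refine hk.abs_average_sub_average_le (hUx _) (hUx _) fun z => ?_
        have e4 := (hUt (t + h) p.1 (x + z)).trans (mul_le_mul_of_nonneg_left e1 hB0)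
        have e5 := hUx p.1 (x + z) (p.2 + z)
        rw [add_sub_add_right_eq_sub] at e5
        have e6 := e5.trans (mul_le_mul_of_nonneg_left e2 hA0)
        rw [abs_le] at *
        constructor <;> linarith [e4.1, e4.2, e6.1, e6.2]
      calc |a p| * |c - V (potentialAverage k (U p.1) p.2)|
          ≤ A * (L * (2 * (B * (3 * h) + A * ((F + 1) * h)) * K)) := by
            refine mul_le_mul (hA p) ?_ (abs_nonneg _) hA0
            exact (hV _ _).trans (mul_le_mul_of_nonneg_left e3 hL)
        _ = _ := by ring)
  have h2 := hUt (t + h) (t + h ^ 2 + h) x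
  have h3 := hUt (t + h ^ 2) t (x - h * c)
  rw [show t + h - (t + h ^ 2 + h) = -h ^ 2 by ring, abs_neg, abs_of_pos hhpos] at h2
  rw [add_sub_cancel_left, abs_of_pos hhpos] at h3
  rw [abs_le] at *
  constructor <;> linarith [h1.1, h1.2, h2.1, h2.2, h3.1, h3.2]

theorem theorem1p1 (u₀ V η : ℝ → ℝ)
    (hu₀ : MemLp u₀ ⊤ volume) (hu₀_range : ∀ᵐ x, 0 ≤ u₀ x ∧ u₀ x ≤ 1)
    (hV : ∃ L, LipschitzWith L V) (hV_anti : AntitoneOn V (Icc 0 1))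
    (hη : IsAnisotropicKernel η) (hη_convex : ConvexOn ℝ (Iio 0) η)
    (hu₀_tv : totVar u₀ < ⊤) :
    ∀ ε : ℝ, 0 < ε →
      (∀ u : ℝ → ℝ → ℝ, IsDistributionalSolution V η ε u₀ u →
        ∀ᵐ t ∂(volume.restrict (Ioi (0 : ℝ))),
          totVar (nonlocalTerm η ε (u t)) ≤ totVar (nonlocalTerm η ε u₀)) ∧
      totVar (nonlocalTerm η ε u₀) ≤ totVar u₀ := by
  intro ε hε
  obtain ⟨hκi, hκs, hκ0, hκm, hκc, ⟨M, hκM⟩, hκ1⟩ := hη.rescaled hη_convex hε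
  refine ⟨fun u hu => ?_, totVar_convolution_le hκi hκ0 hκ1 hu₀⟩
  obtain ⟨L, hVL⟩ := hV
  have hV' : ∀ x y, |V x - V y| ≤ L * |x - y| := fun x y => by
    simpa [Real.dist_eq] using hVL.dist_le_mul x y
  obtain ⟨a, b, v₀, A, B, ham, hA, hbm, hB, hv₀m, hv₀, hv₀e, ha0, hau, hbV, hdiv⟩ :=
    hu.exists_field hu₀.1 hu₀_range L.2 hV' hκi hκ0 hκ1
  obtain ⟨U, hUx, hUt, hUa, hUs⟩ := exists_potential ham hA hbm hB hdiv
  have hB0 : 0 ≤ B := (abs_nonneg _).trans (hB 0)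
  set k := layerKernel (rescaledKernel η ε) with hk
  have hkk : IsDecreasingKernel k :=
    isDecreasingKernel_layerKernel hκi hκs hκ0 hκm hκc hκM hκ1
  have hslice : ∀ t, (∀ x y, U t y - U t x = ∫ s in x..y, a (t, s)) → ∀ x,
      nonlocalTerm η ε (fun y => a (t, y)) x = potentialAverage k (U t) x := fun t ht x =>
    convolution_eq_potentialAverage hκi hκs hκ0 hκm hκc hκM (ham.comp measurable_prodMk_left)
      (fun y => hA _) ht x
  -- The slope formula holds only for almost every time, possibly not at `0`. It is read at negative
  -- times close to `0`, where the field equals `v₀`, and transferred by Lipschitz continuity in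
  -- time.
  have hU0 : ∀ x y, U 0 y - U 0 x = ∫ s in x..y, v₀ s := by
    intro x y
    refine eq_of_abs_sub_nonpos (le_of_forall_pos_le_add fun δ hδ => ?_)
    obtain ⟨t, ht, htδ⟩ := (Measure.dense_of_ae hUa).exists_mem_open isOpen_Ioo
      (nonempty_Ioo.2 (show -(δ / (2 * B + 1)) < 0 by
        rw [neg_lt_zero]; positivity))
    have h1 := ht x y
    simp_rw [ha0 t htδ.2.le] at h1
    have h2 := hUt 0 t x
    have h3 := hUt 0 t y
    have h4 : |0 - t| ≤ δ / (2 * B + 1) := by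
      rw [abs_of_nonneg (by linarith [htδ.2])]; linarith [htδ.1]
    have h5 := mul_le_mul_of_nonneg_left h4 hB0
    have h6 : B * (δ / (2 * B + 1)) + B * (δ / (2 * B + 1)) ≤ δ := by
      rw [← two_mul, ← mul_assoc, ← mul_div_assoc, div_le_iff₀ (by positivity)]
      nlinarith
    rw [← h1, zero_add]
    rw [abs_le] at *
    constructor <;> linarith [h2.1, h2.2, h3.1, h3.2]
  have hmono : Monotone (U 0) := fun x y hxy => by
    rw [← sub_nonneg, hU0]
    exact intervalIntegral.integral_nonneg hxy fun s _ => (hv₀ s).1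
  have hlip : ∀ x y, |U 0 x - U 0 y| ≤ 1 * |x - y| := fun x y => by
    rw [hU0, ← Real.norm_eq_abs]
    refine intervalIntegral.norm_integral_le_of_norm_le_const fun s _ => ?_
    rw [Real.norm_eq_abs, abs_of_nonneg (hv₀ s).1]
    exact (hv₀ s).2
  have hbU : ∀ᵐ p : ℝ × ℝ, 0 < p.1 → b p = a p * V (potentialAverage k (U p.1) p.2) := by
    have h1 : ∀ᵐ p : ℝ × ℝ, ∀ x y, U p.1 y - U p.1 x = ∫ s in x..y, a (p.1, s) :=
      Measure.quasiMeasurePreserving_fst.ae hUa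
    filter_upwards [h1] with p hp hp0
    rw [hbV p hp0, hslice p.1 hp]
  obtain ⟨C, hU⟩ := isTransportedPotential_of_field hkk L.2 hV' hA hB0 hUx hUt hUs hbU hmono hlip
  have hw0 : nonlocalTerm η ε u₀ = potentialAverage k (U 0) := by
    ext x
    rw [nonlocalTerm_congr_ae hv₀e]
    exact convolution_eq_potentialAverage hκi hκs hκ0 hκm hκc hκM hv₀m (R := 1)
      (fun y => by rw [abs_of_nonneg (hv₀ y).1]; exact (hv₀ y).2) hU0 x
  filter_upwards [hau, ae_restrict_of_ae hUa, ae_restrict_mem measurableSet_Ioi] with t ht htU ht0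
  have hwt : nonlocalTerm η ε (u t) = potentialAverage k (U t) := by
    ext x
    rw [nonlocalTerm_congr_ae ht, hslice t htU]
  rw [hwt, hw0]
  -- The initial average is continuous, so its essential variation is its pointwise one; at time `t`
  -- the trivial inequality suffices.
  calc totVar (potentialAverage k (U t)) ≤ eVariationOn (potentialAverage k (U t)) univ :=
        totVar_le_eVariationOn _
    _ ≤ eVariationOn (potentialAverage k (U 0)) univ :=
        hU.eVariationOn_average_le hkk L.2 hV' hV_anti (mem_Ioi.1 ht0).le
    _ ≤ _ := eVariationOn_le_totVar_of_continuous
        (continuous_of_abs_sub_le (hkk.abs_average_sub_le (hUx 0)))
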